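/- **Conventions.** For $n\ge 0$, an $n$-punctured ball tangle diagram is a planar diagram (with finitely many transversal double points with over/under information) of a tangle in a 3-ball from which the interiors of $n$ disjoint balls, the holes $1,\dots,n$, have been removed, with four boundary points, $NW,NE,SW,SE$, on each of the $n+1$ boundary spheres. Diagrams are taken in general position with respect to the height function, so that each is, from bottom to top, a finite sequence of local minima, local maxima, crossings and holes, all at different heights, with the bottom points $SW,SE$ and the top points $NW,NE$ of each hole and of the outer boundary. Two such diagrams are isotopic if they are related by finitely many planar isotopies and Reidemeister moves of types I, II, III and IV (type IV: a strand passes over or under a hole). A ball tangle diagram is a $0$-punctured one, and $T(B^{(1)},\dots,B^{(n)})$ is obtained from $T$ by filling its $k$-th hole with the ball tangle diagram $B^{(k)}$ for each $k$. The numerator closure $B_1$ of a ball tangle diagram $B$ is the link diagram obtained by joining $NW$ to $NE$ and $SW$ to $SE$, and the denominator closure $B_2$ is obtained by joining $NW$ to $SW$ and $NE$ to $SE$. The fundamental ball tangle $1$ consists of two vertical arcs, the fundamental ball tangle $2$ of two horizontal arcs. For a link diagram $L$ let $$\langle L\rangle=\sum_{\sigma}A^{\alpha(\sigma)}(A^{-1})^{\beta(\sigma)}(-A^2-A^{-2})^{d(\sigma)-1},\qquad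 A=e^{i\pi/4},$$ where $\sigma$ runs over all states of $L$ (choices of an $A$- or a $B$-splitting at every crossing, the $A$-splitting being the one that joins the two regions swept out when the over-strand is turned counterclockwise), $\alpha(\sigma)$ and $\beta(\sigma)$ are the numbers of $A$- and $B$-splittings, $d(\sigma)$ is the number of circles of the resulting diagram without crossings, and $0^0=1$ (so that exactly the states with $d(\sigma)=1$, the monocyclic ones, contribute). Let $\alpha^n_1<\dots<\alpha^n_{2^n}$ be the elements of $\{1,2\}^n$ in dictionary order, $\alpha^n_j=(\alpha^n_{j1},\dots,\alpha^n_{jn})$. Let $(t_1,\dots,t_{2^n})$ be the sequence that is $(0)$ for $n=0$ and is obtained for $n+1$ from the one for $n$ by appending to it the same sequence with all terms increased by $1$. For an $n$-punctured ball tangle diagram $T$ let $T_{r\alpha}$ be the closure $r\in\{1,2\}$ of $T$ with its $k$-th hole filled with the fundamental tangle $\alpha_k$ for each $k$, and let $X(T)$ be the complex $2\times 2^n$ matrix with columns $$\begin{pmatrix}(-i)^{t_j}\langle T_{1\alpha^n_j}\rangle\\ (-i)^{t_j}\,i\,\langle T_{2\alpha^n_j}\rangle\end{pmatrix},\qquad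 1\le j\le 2^n .$$ Let $PM_{a\times b}(\mathbb Z)$ be the set of integer $a\times b$ matrices modulo multiplication by $\pm1$, with the induced product $[X][Y]=[XY]$, and let $$[\xi^n]\colon PM_{2\times1}(\mathbb Z)^n\to PM_{2^n\times 1}(\mathbb Z),\qquad [\xi^n]([v^1],\dots,[v^n])=\Big[\Big(\prod_{k=1}^n v^k_{\alpha^n_{jk}}\Big)_{1\le j\le 2^n}\Big].$$ **Theorem.** For every $n\ge 0$: 1. For each $n$-punctured ball tangle diagram $T$, the set $\{zX(T) : z\in\mathbb C,\ z^8=1\}\cap M_{2\times2^n}(\mathbb Z)$ is an element $F^n(T)$ of $PM_{2\times 2^n}(\mathbb Z)$, that is, it has the form $\{M,-M\}$. 2. $F^n$ is an isotopy invariant: if $T$ and $T'$ are isotopic $n$-punctured ball tangle diagrams, then $F^n(T)=F^n(T')$. 3. For each $n$-punctured ball tangle diagram $T$ and all ball tangle diagrams $B^{(1)},\dots,B^{(n)}$, $$F^0\big(T(B^{(1)},\dots,B^{(n)})\big)=F^n(T)\,[\xi^n]\big(F^0(B^{(1)}),\dots,F^0(B^{(n)})\big).$$ -/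

import Mathlib

/-!  # Punctured ball tangle diagrams, the Kauffman bracket and the tangle invariants

All diagrams are planar diagrams in general position with respect to the height function: no two
critical points, crossings or holes are at the same height.  Such a diagram is read from bottom to
top as a finite word of elementary pieces.  Holes (and the outer ball) are drawn as boxes
with the four boundary points `SW`, `SE` (bottom) and `NW`, `NE` (top). -/

namespace BallTangle

/-! ## Diagrams -/

/-- The elementary pieces of a diagram with holes numbered by `Fin n`. -/
inductive Kind (n : ℕ) : Type
  /-- a local minimum `∪` -/
  | cup : Kind n
  /-- a local maximum `∩` -/
  | cap : Kind n
  /-- a crossing of two strands; if the flag is `true` the over-strand is the one that goes from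
  bottom left to top right, otherwise it is the one that goes from bottom right to top left -/
  | cross (up : Bool) : Kind n
  /-- the `k`-th hole, with two strands attached at its bottom and two at its top -/
  | hole (k : Fin n) : Kind n
  deriving DecidableEq

namespace Kind

variable {n : ℕ}

/-- Number of strands that enter a piece from below. -/
def src : Kind n → ℕ
  | cup => 0
  | cap => 2
  | cross _ => 2
  | hole _ => 2

/-- Number of strands that leave a piece at the top. -/
def tgt : Kind n → ℕ
  | cup => 2
  | cap => 0
  | cross _ => 2
  | hole _ => 2

def isCrossing : Kind n → Bool
  | cross _ => true
  | _ => false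

end Kind

/-- A horizontal layer of a diagram: one elementary piece, with `left` vertical strands to the left
of it (and an arbitrary number of vertical strands to the right of it). -/
structure Piece (n : ℕ) : Type where
  kind : Kind n
  left : ℕ

/-- `Fits w a b`: the word `w` of layers, read from bottom to top, describes a diagram with `a`
strands at the bottom and `b` strands at the top. -/
def Fits {n : ℕ} : List (Piece n) → ℕ → ℕ → Prop
  | [], a, b => a = b
  | p :: w, a, b => ∃ r : ℕ, a = p.left + p.kind.src + r ∧ Fits w (p.left + p.kind.tgt + r) b

/-- Put `s` vertical strands to the left of a diagram. -/
def shift {n : ℕ} (s : ℕ) (w : List (Piece n)) : List (Piece n) :=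
  w.map fun p => ⟨p.kind, s + p.left⟩

theorem Fits.append {n : ℕ} {w v : List (Piece n)} {a b c : ℕ} (hw : Fits w a b)
    (hv : Fits v b c) : Fits (w ++ v) a c := by
  induction w generalizing a with
  | nil => cases hw; exact hv
  | cons p w ih =>
    obtain ⟨r, h, h'⟩ := hw
    exact ⟨r, h, ih h'⟩

theorem Fits.shift {n : ℕ} {w : List (Piece n)} {a b : ℕ} (hw : Fits w a b) (s t : ℕ) :
    Fits (shift s w) (s + a + t) (s + b + t) := by
  induction w generalizing a with
  | nil => cases hw; rfl
  | cons p w ih =>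
    obtain ⟨r, h, h'⟩ := hw
    refine ⟨r + t, by simp only; omega, ?_⟩
    have := ih h'
    have e : s + p.left + p.kind.tgt + (r + t) = s + (p.left + p.kind.tgt + r) + t := by omega
    simp only
    rw [e]
    exact this

/-- A link diagram. -/
structure LinkDiagram : Type where
  word : List (Piece 0)
  fits : Fits word 0 0

/-- A diagram of an `n`-punctured ball tangle with four boundary points on each of the `n + 1`
boundary spheres; each of the `n` holes occurs exactly once. -/
structure TangleDiagram (n : ℕ) : Type where
  word : List (Piece n)
  fits : Fits word 2 2
  holes : ∀ k : Fin n, (word.map Piece.kind).count (Kind.hole k) = 1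

/-! ## Filling the holes -/

/-- What becomes of one layer if the holes are filled with the words `B k`. -/
def Piece.fill {n : ℕ} (B : Fin n → List (Piece 0)) : Piece n → List (Piece 0)
  | ⟨Kind.cup, i⟩ => [⟨Kind.cup, i⟩]
  | ⟨Kind.cap, i⟩ => [⟨Kind.cap, i⟩]
  | ⟨Kind.cross b, i⟩ => [⟨Kind.cross b, i⟩]
  | ⟨Kind.hole k, i⟩ => shift i (B k)

theorem Fits.fill {n : ℕ} {B : Fin n → List (Piece 0)} (hB : ∀ k, Fits (B k) 2 2)
    {w : List (Piece n)} {a b : ℕ} (hw : Fits w a b) : Fits (w.flatMap (Piece.fill B)) a b := by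
  induction w generalizing a with
  | nil => exact hw
  | cons p w ih =>
    obtain ⟨r, h, h'⟩ := hw
    rw [List.flatMap_cons]
    refine Fits.append ?_ (ih h')
    subst h
    obtain ⟨kd, i⟩ := p
    cases kd with
    | hole k => exact (hB k).shift i r
    | _ => exact ⟨r, rfl, rfl⟩

/-- The ball tangle diagram `T(B 0, …, B (n - 1))`: the `k`-th hole of `T` is filled with `B k`. -/
def TangleDiagram.fill {n : ℕ} (T : TangleDiagram n) (B : Fin n → TangleDiagram 0) :
    TangleDiagram 0 where
  word := T.word.flatMap (Piece.fill fun k => (B k).word)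
  fits := T.fits.fill fun k => (B k).fits
  holes := fun k => k.elim0

/-- The two fundamental ball tangles, indexed by `0` and `1` in place of `1` and `2`: the first
consists of two vertical strands `)(`, the second of two horizontal arcs. -/
def fundamental : Fin 2 → TangleDiagram 0
  | 0 => ⟨[], rfl, fun k => k.elim0⟩
  | 1 => ⟨[⟨Kind.cap, 0⟩, ⟨Kind.cup, 0⟩], ⟨0, rfl, 0, rfl, rfl⟩, fun k => k.elim0⟩

/-- The two closures of a ball tangle diagram, indexed by `0` and `1` in place of `1` and `2`: the
numerator closure joins `NW` to `NE` and `SW` to `SE`; the denominator closure joins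
`NW` to `SW` and `NE` to `SE`, around the left and the right side of the diagram. -/
def closure (B : TangleDiagram 0) : Fin 2 → LinkDiagram
  | 0 => ⟨[⟨Kind.cup, 0⟩] ++ B.word ++ [⟨Kind.cap, 0⟩],
      ((show Fits [(⟨Kind.cup, 0⟩ : Piece 0)] 0 2 from ⟨0, rfl, rfl⟩).append B.fits).append
        (show Fits [(⟨Kind.cap, 0⟩ : Piece 0)] 2 0 from ⟨0, rfl, rfl⟩)⟩
  | 1 => ⟨[⟨Kind.cup, 0⟩, ⟨Kind.cup, 2⟩] ++ shift 1 B.word ++ [⟨Kind.cap, 0⟩, ⟨Kind.cap, 0⟩],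
      ((show Fits [(⟨Kind.cup, 0⟩ : Piece 0), ⟨Kind.cup, 2⟩] 0 4 from
          ⟨0, rfl, 0, rfl, rfl⟩).append (B.fits.shift 1 1)).append
        (show Fits [(⟨Kind.cap, 0⟩ : Piece 0), ⟨Kind.cap, 0⟩] 4 0 from ⟨2, rfl, 0, rfl, rfl⟩)⟩

/-! ## Isotopy of diagrams -/

/-- The local moves on diagrams.  The first five are planar isotopies, the others are the
Reidemeister moves of type I, II, III and, for a strand that passes over or under a hole, IV. -/
inductive LocalMove {n : ℕ} : List (Piece n) → List (Piece n) → Prop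
  /-- pieces at distant places of the diagram exchange their heights -/
  | exchange (a b : Kind n) (i r : ℕ) : LocalMove
      [⟨a, i⟩, ⟨b, i + a.tgt + r⟩] [⟨b, i + a.src + r⟩, ⟨a, i⟩]
  /-- a zigzag of a strand is straightened -/
  | zigzag_left (i : ℕ) : LocalMove [⟨Kind.cup, i⟩, ⟨Kind.cap, i + 1⟩] []
  | zigzag_right (i : ℕ) : LocalMove [⟨Kind.cup, i + 1⟩, ⟨Kind.cap, i⟩] []
  /-- a crossing slides through a minimum or a maximum -/
  | slide_cup (b : Bool) (i : ℕ) : LocalMove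
      [⟨Kind.cup, i⟩, ⟨Kind.cross b, i + 1⟩] [⟨Kind.cup, i + 1⟩, ⟨Kind.cross (!b), i⟩]
  | slide_cap (b : Bool) (i : ℕ) : LocalMove
      [⟨Kind.cross b, i⟩, ⟨Kind.cap, i + 1⟩] [⟨Kind.cross (!b), i + 1⟩, ⟨Kind.cap, i⟩]
  /-- Reidemeister moves of type I -/
  | one_right (b : Bool) (i : ℕ) : LocalMove
      [⟨Kind.cup, i + 1⟩, ⟨Kind.cross b, i⟩, ⟨Kind.cap, i + 1⟩] []
  | one_left (b : Bool) (i : ℕ) : LocalMove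
      [⟨Kind.cup, i⟩, ⟨Kind.cross b, i + 1⟩, ⟨Kind.cap, i⟩] []
  /-- Reidemeister moves of type II -/
  | two (b : Bool) (i : ℕ) : LocalMove [⟨Kind.cross b, i⟩, ⟨Kind.cross (!b), i⟩] []
  /-- Reidemeister moves of type III; the hypothesis says that the three strands lie at three
  different levels, rather than cyclically above each other -/
  | three (b c d : Bool) (h : b = d → c = b) (i : ℕ) : LocalMove
      [⟨Kind.cross b, i⟩, ⟨Kind.cross c, i + 1⟩, ⟨Kind.cross d, i⟩]
      [⟨Kind.cross d, i + 1⟩, ⟨Kind.cross c, i⟩, ⟨Kind.cross b, i + 1⟩]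
  /-- Reidemeister moves of type IV -/
  | four_right (k : Fin n) (b : Bool) (i : ℕ) : LocalMove
      [⟨Kind.hole k, i⟩, ⟨Kind.cross b, i + 1⟩, ⟨Kind.cross b, i⟩]
      [⟨Kind.cross b, i + 1⟩, ⟨Kind.cross b, i⟩, ⟨Kind.hole k, i + 1⟩]
  | four_left (k : Fin n) (b : Bool) (i : ℕ) : LocalMove
      [⟨Kind.hole k, i + 1⟩, ⟨Kind.cross b, i⟩, ⟨Kind.cross b, i + 1⟩]
      [⟨Kind.cross b, i⟩, ⟨Kind.cross b, i + 1⟩, ⟨Kind.hole k, i⟩]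

/-- `T'` is obtained from `T` by one local move. -/
def TangleDiagram.Move {n : ℕ} (T T' : TangleDiagram n) : Prop :=
  ∃ u v x y : List (Piece n), LocalMove x y ∧ T.word = u ++ x ++ v ∧ T'.word = u ++ y ++ v

/-- Isotopy of diagrams: they are related by finitely many local moves and their inverses. -/
def TangleDiagram.Isotopic {n : ℕ} (T T' : TangleDiagram n) : Prop :=
  Relation.EqvGen TangleDiagram.Move T T'

/-! ## States and the Kauffman bracket -/

/-- The two ways of splitting a crossing. -/
inductive Splitting : Type
  | A : Splitting
  | B : Splitting
  deriving DecidableEq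

instance Splitting.instFintype : Fintype Splitting :=
  ⟨{Splitting.A, Splitting.B}, fun x => by cases x <;> simp⟩

/-- The crossings of a diagram, given by their positions in the word. -/
abbrev Crossing (w : List (Piece 0)) : Type :=
  {l : Fin w.length // (w.get l).kind.isCrossing = true}

/-- A state chooses a splitting for each crossing. -/
abbrev State (w : List (Piece 0)) : Type := Crossing w → Splitting

/-- Split a crossing.  When the over-strand goes from bottom left to top right, turning it
counterclockwise sweeps the top and the bottom region; so these are the `A`-regions, and the
`A`-splitting, which opens a channel between them, gives two vertical strands (no piece at all) while
the `B`-splitting gives a maximum below a minimum.  For the other crossing it is the other way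
round.  Pieces that are not crossings are left alone. -/
def Piece.split : Piece 0 → Splitting → List (Piece 0)
  | ⟨Kind.cross true, _⟩, Splitting.A => []
  | ⟨Kind.cross true, i⟩, Splitting.B => [⟨Kind.cap, i⟩, ⟨Kind.cup, i⟩]
  | ⟨Kind.cross false, i⟩, Splitting.A => [⟨Kind.cap, i⟩, ⟨Kind.cup, i⟩]
  | ⟨Kind.cross false, _⟩, Splitting.B => []
  | p, _ => [p]

/-- The diagram without crossings that a state produces. -/
def resolve (w : List (Piece 0)) (σ : State w) : List (Piece 0) :=
  (List.ofFn fun l : Fin w.length =>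
    if h : (w.get l).kind.isCrossing = true then (w.get l).split (σ ⟨l, h⟩)
    else [w.get l]).flatten

/-- Number of strands of a diagram, with no strand at the bottom, just above its first `l` layers. -/
def levelWidth {n : ℕ} (w : List (Piece n)) (l : ℕ) : ℕ :=
  (w.take l).foldl (fun c p => c + p.kind.tgt - p.kind.src) 0

/-- The points in which a diagram meets the horizontal lines between its layers: `(l, x)` is the
`x`-th point from the left, counted from `0`, on the line just above the first `l` layers. -/
abbrev Point {n : ℕ} (w : List (Piece n)) : Type :=
  {q : ℕ × ℕ // q.1 ≤ w.length ∧ q.2 < levelWidth w q.1}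

/-- Two points of a diagram without crossings and holes are ends of the same arc in one layer. -/
inductive Joined {n : ℕ} (w : List (Piece n)) : ℕ × ℕ → ℕ × ℕ → Prop
  | left (l x : ℕ) (p : Piece n) (hp : w[l]? = some p) (hx : x < p.left) :
      Joined w (l, x) (l + 1, x)
  | right (l x : ℕ) (p : Piece n) (hp : w[l]? = some p) :
      Joined w (l, p.left + p.kind.src + x) (l + 1, p.left + p.kind.tgt + x)
  | cup (l i : ℕ) (hp : w[l]? = some ⟨Kind.cup, i⟩) : Joined w (l + 1, i) (l + 1, i + 1)
  | cap (l i : ℕ) (hp : w[l]? = some ⟨Kind.cap, i⟩) : Joined w (l, i) (l, i + 1)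

/-- The number of circles of a closed diagram without crossings and holes: the number of classes of
points under the equivalence relation generated by the arcs. -/
noncomputable def circles {n : ℕ} (w : List (Piece n)) : ℕ :=
  Nat.card (Quot fun p q : Point w => Joined w p.1 q.1)

/-- The Kauffman bracket of a (nonempty) link diagram. -/
noncomputable def kauffmanBracket (A : ℂ) (L : LinkDiagram) : ℂ :=
  ∑ σ : State L.word,
    A ^ (Finset.univ.filter fun c => σ c = Splitting.A).card *
      A⁻¹ ^ (Finset.univ.filter fun c => σ c = Splitting.B).card *
      (-A ^ 2 - A⁻¹ ^ 2) ^ (circles (resolve L.word σ) - 1)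

/-- The Kauffman bracket at `A = exp (i π / 4)`. -/
noncomputable def bracket (L : LinkDiagram) : ℂ :=
  kauffmanBracket (Complex.exp (Complex.I * Real.pi / 4)) L

/-! ## Integer matrices up to sign -/

/-- Equality up to sign. -/
def signSetoid (a b : ℕ) : Setoid (Matrix (Fin a) (Fin b) ℤ) where
  r X Y := X = Y ∨ X = -Y
  iseqv :=
    { refl := fun _ => Or.inl rfl
      symm := by
        rintro X Y (h | h)
        · exact Or.inl h.symm
        · exact Or.inr (by rw [h, neg_neg])
      trans := by
        rintro X Y Z (rfl | rfl) (rfl | rfl)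
        · exact Or.inl rfl
        · exact Or.inr rfl
        · exact Or.inr rfl
        · exact Or.inl (neg_neg _) }

/-- `PM a b`: the `a × b` integer matrices up to multiplication by `±1`. -/
def PM (a b : ℕ) : Type := Quotient (signSetoid a b)

/-- The class of a matrix up to sign. -/
def PM.mk {a b : ℕ} (X : Matrix (Fin a) (Fin b) ℤ) : PM a b := Quotient.mk (signSetoid a b) X

instance PM.instNonempty (a b : ℕ) : Nonempty (PM a b) := ⟨PM.mk 0⟩

/-- The product `[X] [Y] = [X Y]`. -/
def PM.mul {a b c : ℕ} (X : PM a b) (Y : PM b c) : PM a c :=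
  Quotient.map₂ (sa := signSetoid a b) (sb := signSetoid b c) (sc := signSetoid a c)
    (fun X Y => X * Y)
    (by
      rintro X X' (rfl | rfl) Y Y' (rfl | rfl)
      · exact Or.inl rfl
      · exact Or.inr (Matrix.mul_neg _ _)
      · exact Or.inr (Matrix.neg_mul _ _)
      · exact Or.inl (by rw [Matrix.neg_mul, Matrix.mul_neg, neg_neg])) X Y

/-- `alpha n j` is the `j`-th element of `{1, 2} ^ n` in the dictionary order (with `0` and `1` in
place of `1` and `2`). -/
noncomputable def alpha (n : ℕ) (j : Fin (2 ^ n)) : Fin n → Fin 2 :=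
  ofLex (monoEquivOfFin (Lex (Fin n → Fin 2)) (k := 2 ^ n) (by simp) j)

/-- The dictionary order function on `n` vectors of length two, written as columns. -/
noncomputable def xi {n : ℕ} (v : Fin n → Matrix (Fin 2) (Fin 1) ℤ) :
    Matrix (Fin (2 ^ n)) (Fin 1) ℤ :=
  fun j c => ∏ k : Fin n, v k (alpha n j k) c

theorem xi_sign {n : ℕ} (v w : Fin n → Matrix (Fin 2) (Fin 1) ℤ)
    (h : ∀ k, v k = w k ∨ v k = -w k) : xi v = xi w ∨ xi v = -xi w := by
  have h' : ∀ k, ∃ e : ℤ, (e = 1 ∨ e = -1) ∧ v k = e • w k := fun k => by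
    rcases h k with h | h
    · exact ⟨1, Or.inl rfl, by simpa using h⟩
    · exact ⟨-1, Or.inr rfl, by simpa using h⟩
  choose e he hv using h'
  have key : xi v = (∏ k, e k) • xi w := by
    ext j c
    simp [xi, hv, Finset.prod_mul_distrib]
  have hs : ∏ k, e k = 1 ∨ ∏ k, e k = -1 := by
    refine Finset.prod_induction e (fun x => x = 1 ∨ x = -1) ?_ (Or.inl rfl) fun k _ => he k
    rintro a b (rfl | rfl) (rfl | rfl) <;> simp
  rcases hs with hs | hs
  · exact Or.inl (by rw [key, hs, one_smul])
  · exact Or.inr (by rw [key, hs, neg_one_smul])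

/-- The dictionary order function on columns up to sign. -/
noncomputable def PM.xi {n : ℕ} (v : Fin n → PM 2 1) : PM (2 ^ n) 1 :=
  Quotient.finLiftOn (S := fun _ : Fin n => signSetoid 2 1) v
    (fun v => PM.mk (BallTangle.xi v))
    fun v w h => Quotient.sound (s := signSetoid (2 ^ n) 1) (xi_sign v w h)

theorem PM.xi_mk {n : ℕ} (v : Fin n → Matrix (Fin 2) (Fin 1) ℤ) :
    PM.xi (fun k => PM.mk (v k)) = PM.mk (BallTangle.xi v) := by
  have := Quotient.finLiftOn_mk (S := fun _ : Fin n => signSetoid 2 1) (β := PM (2 ^ n) 1) v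
  exact congrFun (congrFun this _) _

/-! ## The invariants -/

/-- The exponents `t_j`, for `j < 2 ^ n`: the sequence for `n + 1` is the sequence for `n` followed
by the same sequence with all terms increased by one. -/
def texp : ℕ → ℕ → ℕ
  | 0, _ => 0
  | n + 1, j => if j < 2 ^ n then texp n j else texp n (j - 2 ^ n) + 1

/-- The matrix of brackets `(-i) ^ t_j ⟨T_{1 α_j}⟩` (first row), `(-i) ^ t_j i ⟨T_{2 α_j}⟩` (second
row), where `T_{r α}` is the closure `r` of `T` with its holes filled with the fundamental tangles
given by `α`. -/
noncomputable def bracketMatrix {n : ℕ} (T : TangleDiagram n) : Matrix (Fin 2) (Fin (2 ^ n)) ℂ :=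
  fun r j => (-Complex.I) ^ texp n j * Complex.I ^ (r : ℕ) *
    bracket (closure (T.fill fun k => fundamental (alpha n j k)) r)

/-- The integer matrices among the multiples of the bracket matrix by eighth roots of unity. -/
def integralMultiples {n : ℕ} (T : TangleDiagram n) : Set (Matrix (Fin 2) (Fin (2 ^ n)) ℤ) :=
  {M | ∃ z : ℂ, z ^ 8 = 1 ∧ M.map (fun m : ℤ => (m : ℂ)) = z • bracketMatrix T}

/-- The `n`-punctured ball tangle invariant: the class up to sign that consists of the integral
multiples of the bracket matrix by eighth roots of unity (an arbitrary class if there is no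
such class). -/
noncomputable def F {n : ℕ} (T : TangleDiagram n) : PM 2 (2 ^ n) :=
  Classical.epsilon fun q => {M | PM.mk M = q} = integralMultiples T

end BallTangle

namespace BallTangle

/-! ## Temperley-Lieb representations -/

/-! At `A = e^{iπ/4}` the loop value `d = -A² - A⁻²` is zero. A diagram is read as a product in a
Temperley-Lieb representation, crossings and holes being expanded into the identity `1` and the
maximum-below-minimum `U`. A crossingless diagram from 2 to 2 strands reduces to `dᵏ·1` or `dᵏ·U`,
so at `d = 0` a ball tangle `B` has the value `⟨B₁⟩·1 + ⟨B₂⟩·U` (`TLRep.val_eq_bracket`). In any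
nonzero representation with `d = 0` these coefficients are unique (`TLRep.coeff_unique`), and one
exists (`exists_zeroRep`); identities of brackets thus follow from identities of values. Since the
bracket counts circles as classes of points, `Plain.circles_eq` links this count to the algebra:
there are `2 ^ circles` two-colourings, and the representation with loop value 2 counts them.

Filling: values are multilinear in the coefficients of the holes (`bracket_fill`), and the powers of
`i` in the matrices cancel (`bracketMatrix_fill`).

Isotopy: a local move multiplies the value by `1`, `-A³` or `-A⁻³`, whatever the hole coefficients
are (`TLRep.val_localMove`), hence the whole matrix by one eighth root of unity.

Integrality: up to an eighth root of unity a crossing is `1 ± iU`, and a weighted fundamental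
filling is `1` or `-iU`. The one-dimensional representation with loop value `-1` sends `U` to `-1`;
weighting crossingless words by `1` or `i` according to this sign spans lattices that all pieces
preserve (`exists_val_mem_lattice`). From 2 to 2 strands the lattice consists of `m·1 + l·iU` with
integers `m`, `l`, and the factor `i` in the second row makes the matrix integral. Two integral
multiples agree up to sign (`eq_or_eq_neg_of_map_eq_smul`). -/

/-- A representation of the Temperley-Lieb category with loop value `d`, with infinitely many
strands to the right: minima `cup i` and maxima `cap i` at all positions `i`, composed from bottom
to top. -/
structure TLRep (R E : Type) [CommRing R] [Ring E] [Algebra R E] (d : R) : Type where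
  cup : ℕ → E
  cap : ℕ → E
  zigzag_left : ∀ i, cup i * cap (i + 1) = 1
  zigzag_right : ∀ i, cup (i + 1) * cap i = 1
  loop : ∀ i, cup i * cap i = d • (1 : E)
  cup_cup : ∀ i r, cup i * cup (i + 2 + r) = cup (i + r) * cup i
  cup_cap : ∀ i r, cup i * cap (i + 2 + r) = cap (i + r) * cup i
  cap_cup : ∀ i r, cap i * cup (i + r) = cup (i + 2 + r) * cap i
  cap_cap : ∀ i r, cap i * cap (i + r) = cap (i + 2 + r) * cap i

/-- The coefficients of the two splittings of a crossing in the Kauffman bracket with variable `A`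
and inverse `B`. -/
def crossCoeff {R : Type} (A B : R) : Bool → Fin 2 → R
  | true => ![A, B]
  | false => ![B, A]

namespace TLRep

variable {R E : Type} [CommRing R] [Ring E] [Algebra R E] {d : R} (ρ : TLRep R E d)

/-- The generator of the Temperley-Lieb algebra: a maximum below a minimum. -/
def gen (i : ℕ) : E := ρ.cap i * ρ.cup i

/-- The representation in which all positions are shifted by `s`. -/
def shiftBy (s : ℕ) : TLRep R E d where
  cup i := ρ.cup (s + i)
  cap i := ρ.cap (s + i)
  zigzag_left i := ρ.zigzag_left (s + i)
  zigzag_right i := ρ.zigzag_right (s + i)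
  loop i := ρ.loop (s + i)
  cup_cup i r := by simpa only [add_assoc] using ρ.cup_cup (s + i) r
  cup_cap i r := by simpa only [add_assoc] using ρ.cup_cap (s + i) r
  cap_cup i r := by simpa only [add_assoc] using ρ.cap_cup (s + i) r
  cap_cap i r := by simpa only [add_assoc] using ρ.cap_cap (s + i) r

theorem gen_mul_self (i : ℕ) : ρ.gen i * ρ.gen i = d • ρ.gen i := by
  rw [gen, mul_assoc, ← mul_assoc (ρ.cup i), ρ.loop, smul_one_mul, mul_smul_comm]

theorem cup_gen_succ (i : ℕ) : ρ.cup i * ρ.gen (i + 1) = ρ.cup (i + 1) := by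
  rw [gen, ← mul_assoc, ρ.zigzag_left, one_mul]

theorem cup_succ_gen (i : ℕ) : ρ.cup (i + 1) * ρ.gen i = ρ.cup i := by
  rw [gen, ← mul_assoc, ρ.zigzag_right, one_mul]

theorem gen_cap_succ (i : ℕ) : ρ.gen i * ρ.cap (i + 1) = ρ.cap i := by
  rw [gen, mul_assoc, ρ.zigzag_left, mul_one]

theorem gen_succ_cap (i : ℕ) : ρ.gen (i + 1) * ρ.cap i = ρ.cap (i + 1) := by
  rw [gen, mul_assoc, ρ.zigzag_right, mul_one]

theorem gen_gen_succ_gen (i : ℕ) : ρ.gen i * (ρ.gen (i + 1) * ρ.gen i) = ρ.gen i := by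
  nth_rewrite 3 [gen]
  rw [← mul_assoc, ← mul_assoc, mul_assoc (ρ.gen i), ρ.gen_succ_cap, ρ.gen_cap_succ, gen]

theorem gen_succ_gen_gen_succ (i : ℕ) :
    ρ.gen (i + 1) * (ρ.gen i * ρ.gen (i + 1)) = ρ.gen (i + 1) := by
  nth_rewrite 3 [gen]
  rw [← mul_assoc, ← mul_assoc, mul_assoc (ρ.gen (i + 1)), ρ.gen_cap_succ, ρ.gen_succ_cap, gen]

theorem cup_mul_gen (i r : ℕ) : ρ.cup i * ρ.gen (i + 2 + r) = ρ.gen (i + r) * ρ.cup i := by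
  rw [gen, ← mul_assoc, ρ.cup_cap, mul_assoc, ρ.cup_cup, ← mul_assoc, gen]

theorem cap_mul_gen (i r : ℕ) : ρ.cap i * ρ.gen (i + r) = ρ.gen (i + 2 + r) * ρ.cap i := by
  rw [gen, ← mul_assoc, ρ.cap_cap, mul_assoc, ρ.cap_cup, ← mul_assoc, gen]

theorem gen_mul_cup (i r : ℕ) : ρ.gen i * ρ.cup (i + 2 + r) = ρ.cup (i + 2 + r) * ρ.gen i := by
  rw [gen, mul_assoc, ρ.cup_cup, ← mul_assoc, ρ.cap_cup, mul_assoc]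

theorem gen_mul_cap (i r : ℕ) : ρ.gen i * ρ.cap (i + 2 + r) = ρ.cap (i + 2 + r) * ρ.gen i := by
  rw [gen, mul_assoc, ρ.cup_cap, ← mul_assoc, ρ.cap_cap, mul_assoc]

theorem gen_mul_gen (i r : ℕ) : ρ.gen i * ρ.gen (i + 2 + r) = ρ.gen (i + 2 + r) * ρ.gen i := by
  rw [gen, mul_assoc, ρ.cup_mul_gen, ← mul_assoc, ρ.cap_mul_gen, mul_assoc]

/-! ## Values of diagrams -/

variable {n : ℕ} (x : Bool → Fin 2 → R) (c : Fin n → Fin 2 → R)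

/-- The value of an elementary piece, where crossings and holes are replaced by the linear
combinations of two vertical strands and of a maximum below a minimum that are given by `x`, `c`. -/
def kindVal : Kind n → ℕ → E
  | Kind.cup, i => ρ.cup i
  | Kind.cap, i => ρ.cap i
  | Kind.cross b, i => x b 0 • 1 + x b 1 • ρ.gen i
  | Kind.hole k, i => c k 0 • 1 + c k 1 • ρ.gen i

/-- The value of a diagram. -/
def val (w : List (Piece n)) : E := (w.map fun p => ρ.kindVal x c p.kind p.left).prod

@[simp] theorem val_nil : ρ.val x c [] = 1 := rfl

@[simp] theorem val_cons (p : Piece n) (w : List (Piece n)) :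
    ρ.val x c (p :: w) = ρ.kindVal x c p.kind p.left * ρ.val x c w := by simp [val]

@[simp] theorem val_append (v w : List (Piece n)) :
    ρ.val x c (v ++ w) = ρ.val x c v * ρ.val x c w := by simp [val]

theorem kindVal_shiftBy (s : ℕ) (k : Kind n) (i : ℕ) :
    (ρ.shiftBy s).kindVal x c k i = ρ.kindVal x c k (s + i) := by
  cases k <;> rfl

theorem val_shift (s : ℕ) (w : List (Piece n)) :
    ρ.val x c (BallTangle.shift s w) = (ρ.shiftBy s).val x c w := by
  simp only [val, BallTangle.shift, List.map_map, kindVal_shiftBy]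
  rfl

/-- After expansion into identities and generators only the far commutation relations are needed.
The position of the right piece changes because the left piece may create or remove strands. -/
theorem kindVal_exchange (a b : Kind n) (i r : ℕ) :
    ρ.kindVal x c a i * ρ.kindVal x c b (i + a.tgt + r) =
      ρ.kindVal x c b (i + a.src + r) * ρ.kindVal x c a i := by
  cases a <;> cases b <;>
    simp only [kindVal, Kind.src, Kind.tgt, add_zero, mul_add, add_mul, smul_mul_assoc,
      mul_smul_comm, mul_one, one_mul, cup_cup, cup_cap, cap_cup, cap_cap, cup_mul_gen,
      cap_mul_gen, gen_mul_cup, gen_mul_cap, gen_mul_gen] <;> module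

/-- Local moves change the value of a diagram at most by the factors that belong to Reidemeister
moves of type I, irrespective of the coefficients of the holes. -/
theorem val_localMove {A B : R} (hAB : A * B = 1) (hd : d = -A ^ 2 - B ^ 2)
    {v w : List (Piece n)} (h : LocalMove v w) :
    ∃ z : R, (z = 1 ∨ z = -A ^ 3 ∨ z = -B ^ 3) ∧
      ∀ c : Fin n → Fin 2 → R,
        ρ.val (crossCoeff A B) c v = z • ρ.val (crossCoeff A B) c w := by
  -- Removing a type I curl: one splitting leaves a circle, the other a plain strand.
  have kink : A * d + B = -A ^ 3 := by subst hd; linear_combination -B * hAB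
  have kink' : B * d + A = -B ^ 3 := by subst hd; linear_combination -A * hAB
  -- The coefficients of `gen i` on the two sides of a type III move. Those of `gen (i + 1)` give
  -- the same identity with the sides exchanged, and all other coefficients agree at once.
  have braid : ∀ b c e : Bool, (b = e → c = b) →
      crossCoeff A B b 1 * crossCoeff A B c 0 * crossCoeff A B e 0 +
        crossCoeff A B b 0 * crossCoeff A B c 0 * crossCoeff A B e 1 +
        crossCoeff A B b 1 * crossCoeff A B c 0 * crossCoeff A B e 1 * d +
        crossCoeff A B b 1 * crossCoeff A B c 1 * crossCoeff A B e 1 =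
      crossCoeff A B b 0 * crossCoeff A B c 1 * crossCoeff A B e 0 := by
    subst hd
    rintro (_ | _) (_ | _) (_ | _) h <;>
      simp only [crossCoeff, Matrix.cons_val_zero, Matrix.cons_val_one] <;> simp at h
    · linear_combination (-A ^ 3 - A * B ^ 2) * hAB
    · linear_combination (-B ^ 3 - B * A ^ 2) * hAB
    · linear_combination (-A ^ 3 - A * B ^ 2) * hAB
    · linear_combination (-B ^ 3 - B * A ^ 2) * hAB
    · linear_combination (-A ^ 3 - A * B ^ 2) * hAB
    · linear_combination (-B ^ 3 - B * A ^ 2) * hAB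
  -- The coefficient of `gen` in a crossing times its inverse. It also settles type IV: a strand
  -- passing a hole that is filled with `gen` yields this coefficient times one generator, plus a
  -- term common to both sides.
  have quad : ∀ b : Bool, crossCoeff A B b 0 * crossCoeff A B b 0 +
      crossCoeff A B b 0 * crossCoeff A B b 1 * d +
        crossCoeff A B b 1 * crossCoeff A B b 1 = 0 := by
    subst hd
    rintro (_ | _) <;> simp only [crossCoeff, Matrix.cons_val_zero, Matrix.cons_val_one] <;>
      linear_combination (-A ^ 2 - B ^ 2) * hAB
  cases h with
  | exchange a b i r =>
    refine ⟨1, Or.inl rfl, fun c => ?_⟩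
    simp [kindVal_exchange]
  | zigzag_left i => exact ⟨1, Or.inl rfl, fun c => by simp [kindVal, ρ.zigzag_left]⟩
  | zigzag_right i => exact ⟨1, Or.inl rfl, fun c => by simp [kindVal, ρ.zigzag_right]⟩
  | slide_cup b i =>
    refine ⟨1, Or.inl rfl, fun c => ?_⟩
    cases b <;> simp [kindVal, crossCoeff, mul_add, cup_gen_succ, cup_succ_gen, add_comm]
  | slide_cap b i =>
    refine ⟨1, Or.inl rfl, fun c => ?_⟩
    cases b <;> simp [kindVal, crossCoeff, add_mul, gen_cap_succ, gen_succ_cap, add_comm]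
  | one_right b i =>
    cases b
    · refine ⟨-B ^ 3, by simp, fun c => ?_⟩
      simp [kindVal, crossCoeff, add_mul, mul_add, gen_cap_succ, zigzag_right, loop, ← kink',
        smul_smul, add_smul]
    · refine ⟨-A ^ 3, by simp, fun c => ?_⟩
      simp [kindVal, crossCoeff, add_mul, mul_add, gen_cap_succ, zigzag_right, loop, ← kink,
        smul_smul, add_smul]
  | one_left b i =>
    cases b
    · refine ⟨-B ^ 3, by simp, fun c => ?_⟩
      simp [kindVal, crossCoeff, add_mul, mul_add, gen_succ_cap, zigzag_left, loop, ← kink',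
        smul_smul, add_smul]
    · refine ⟨-A ^ 3, by simp, fun c => ?_⟩
      simp [kindVal, crossCoeff, add_mul, mul_add, gen_succ_cap, zigzag_left, loop, ← kink,
        smul_smul, add_smul]
  | two b i =>
    refine ⟨1, Or.inl rfl, fun c => ?_⟩
    have h₁ := quad b
    have h₂ : crossCoeff A B b 0 * crossCoeff A B b 1 = 1 := by
      cases b
      · exact (mul_comm B A).trans hAB
      · exact hAB
    have h₃ : crossCoeff A B (!b) 0 = crossCoeff A B b 1 := by cases b <;> rfl
    have h₄ : crossCoeff A B (!b) 1 = crossCoeff A B b 0 := by cases b <;> rfl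
    simp only [val_cons, val_nil, kindVal, add_mul, mul_add, smul_mul_assoc,
      mul_smul_comm, mul_one, one_mul, gen_mul_self, h₃, h₄]
    linear_combination (norm := module) h₂ • (1 : E) + h₁ • ρ.gen i
  | three b c' e h i =>
    refine ⟨1, Or.inl rfl, fun c => ?_⟩
    have := braid b c' e h
    simp only [val_cons, val_nil, kindVal, add_mul, mul_add, smul_mul_assoc,
        mul_smul_comm, mul_one, one_mul, gen_mul_self, gen_gen_succ_gen, gen_succ_gen_gen_succ]
    linear_combination (norm := module) this • (ρ.gen i) - this • (ρ.gen (i + 1))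
  | four_right k b i =>
    refine ⟨1, Or.inl rfl, fun c => ?_⟩
    simp only [val_cons, val_nil, kindVal, add_mul, mul_add, smul_mul_assoc,
        mul_smul_comm, mul_one, one_mul, gen_mul_self, gen_gen_succ_gen, gen_succ_gen_gen_succ]
    linear_combination (norm := module)
      (c k 1 • quad b) • (ρ.gen i) - (c k 1 • quad b) • (ρ.gen (i + 1))
  | four_left k b i =>
    refine ⟨1, Or.inl rfl, fun c => ?_⟩
    simp only [val_cons, val_nil, kindVal, add_mul, mul_add, smul_mul_assoc,
        mul_smul_comm, mul_one, one_mul, gen_mul_self, gen_gen_succ_gen, gen_succ_gen_gen_succ]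
    linear_combination (norm := module)
      (c k 1 • quad b) • (ρ.gen (i + 1)) - (c k 1 • quad b) • (ρ.gen i)

end TLRep

/-! ## Diagrams without crossings and holes -/

theorem fits_append_iff {n : ℕ} {w v : List (Piece n)} {a c : ℕ} :
    Fits (w ++ v) a c ↔ ∃ b, Fits w a b ∧ Fits v b c := by
  refine ⟨fun h => ?_, fun ⟨b, hw, hv⟩ => hw.append hv⟩
  induction w generalizing a with
  | nil => exact ⟨a, rfl, h⟩
  | cons p w ih =>
    obtain ⟨r, h, h'⟩ := h
    obtain ⟨b, h₁, h₂⟩ := ih h'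
    exact ⟨b, ⟨r, h, h₁⟩, h₂⟩

/-- A word without crossings and holes. -/
def Plain {n : ℕ} (w : List (Piece n)) : Prop :=
  ∀ p ∈ w, p.kind = Kind.cup ∨ p.kind = Kind.cap

theorem Plain.append {n : ℕ} {v w : List (Piece n)} (hv : Plain v) (hw : Plain w) :
    Plain (v ++ w) := fun p hp => (List.mem_append.1 hp).elim (hv p) (hw p)

theorem Plain.shift {n : ℕ} {w : List (Piece n)} (hw : Plain w) (s : ℕ) : Plain (shift s w) := by
  intro p hp
  obtain ⟨q, hq, rfl⟩ := List.mem_map.1 hp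
  exact hw q hq

/-- The word `w'` is obtained from `w` by planar isotopies and removal of `k` circles. -/
structure Reduces {n : ℕ} (k : ℕ) (w w' : List (Piece n)) : Prop where
  fits : ∀ {a b : ℕ}, Fits w a b → Fits w' a b
  val : ∀ {R E : Type} [CommRing R] [Ring E] [Algebra R E] {d : R} (ρ : TLRep R E d)
    (x : Bool → Fin 2 → R) (c : Fin n → Fin 2 → R), ρ.val x c w = d ^ k • ρ.val x c w'

namespace Reduces

variable {n : ℕ}

theorem refl (w : List (Piece n)) : Reduces 0 w w := ⟨id, fun ρ x c => by simp⟩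

theorem trans {k l : ℕ} {u v w : List (Piece n)} (h : Reduces k u v) (h' : Reduces l v w) :
    Reduces (k + l) u w :=
  ⟨fun H => h'.fits (h.fits H), fun ρ x c => by rw [h.val, h'.val, smul_smul, pow_add]⟩

theorem append_left {k : ℕ} {v w : List (Piece n)} (h : Reduces k v w) (u : List (Piece n)) :
    Reduces k (u ++ v) (u ++ w) :=
  ⟨fun H => by
    obtain ⟨b, h₁, h₂⟩ := fits_append_iff.1 H
    exact h₁.append (h.fits h₂), fun ρ x c => by simp [h.val]⟩

theorem append_right {k : ℕ} {v w : List (Piece n)} (h : Reduces k v w) (u : List (Piece n)) :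
    Reduces k (v ++ u) (w ++ u) :=
  ⟨fun H => by
    obtain ⟨b, h₁, h₂⟩ := fits_append_iff.1 H
    exact (h.fits h₁).append h₂, fun ρ x c => by simp [h.val]⟩

/-- A minimum directly below a maximum either cancels or exchanges its height with it. -/
theorem cup_cap (i j : ℕ) :
    (∃ k, Reduces (n := n) k [⟨Kind.cup, i⟩, ⟨Kind.cap, j⟩] []) ∨
      ∃ i' j', Reduces (n := n) 0 [⟨Kind.cup, i⟩, ⟨Kind.cap, j⟩]
        [⟨Kind.cap, j'⟩, ⟨Kind.cup, i'⟩] := by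
  rcases lt_trichotomy i j with h | rfl | h
  · rcases (Nat.succ_le_of_lt h).eq_or_lt with rfl | h
    · exact Or.inl ⟨0, ⟨fun {a b} => by simp [Fits, Kind.src, Kind.tgt]; omega,
        fun ρ x c => by simp [TLRep.kindVal, ρ.zigzag_left]⟩⟩
    · obtain ⟨r, rfl⟩ := Nat.exists_eq_add_of_le (Nat.succ_le_of_lt h)
      refine Or.inr ⟨i, i + r, ⟨fun {a b} => ?_, fun ρ x c => ?_⟩⟩
      · simp only [Fits, Kind.src, Kind.tgt]
        rintro ⟨s, h₁, t, h₂, h₃⟩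
        exact ⟨t, by omega, t + r, by omega, by omega⟩
      · simpa [TLRep.kindVal] using ρ.cup_cap i r
  · exact Or.inl ⟨1, ⟨fun {a b} => by simp [Fits, Kind.src, Kind.tgt]; omega,
      fun ρ x c => by simp [TLRep.kindVal, ρ.loop]⟩⟩
  · rcases (Nat.succ_le_of_lt h).eq_or_lt with rfl | h
    · exact Or.inl ⟨0, ⟨fun {a b} => by simp [Fits, Kind.src, Kind.tgt]; omega,
        fun ρ x c => by simp [TLRep.kindVal, ρ.zigzag_right]⟩⟩
    · obtain ⟨r, rfl⟩ := Nat.exists_eq_add_of_le (Nat.succ_le_of_lt h)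
      refine Or.inr ⟨j + r, j, ⟨fun {a b} => ?_, fun ρ x c => ?_⟩⟩
      · simp only [Fits, Kind.src, Kind.tgt]
        rintro ⟨s, h₁, t, h₂, h₃⟩
        exact ⟨r + s, by omega, s, by omega, by omega⟩
      · simpa [TLRep.kindVal] using (ρ.cap_cup j r).symm

end Reduces

/-! ### Normal form of words without crossings and holes. -/

/-- A word of minima at given positions. -/
def cups (n : ℕ) (l : List ℕ) : List (Piece n) := l.map (Piece.mk Kind.cup)

/-- A word of maxima at given positions. -/
def caps (n : ℕ) (l : List ℕ) : List (Piece n) := l.map (Piece.mk Kind.cap)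

theorem fits_cups {n : ℕ} {l : List ℕ} {a b : ℕ} (h : Fits (cups n l) a b) :
    b = a + 2 * l.length := by
  induction l generalizing a with
  | nil => exact h.symm
  | cons i l ih =>
    obtain ⟨r, h, h'⟩ := h
    have := ih h'
    simp only [Kind.src, Kind.tgt, List.length_cons] at *
    omega

theorem fits_caps {n : ℕ} {l : List ℕ} {a b : ℕ} (h : Fits (caps n l) a b) :
    a = b + 2 * l.length := by
  induction l generalizing a with
  | nil => exact h
  | cons i l ih =>
    obtain ⟨r, h, h'⟩ := h
    have := ih h'
    simp only [Kind.src, Kind.tgt, List.length_cons] at *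
    omega

/-- The maximum sinks through the minima, last one first, until it cancels against one of them or
arrives below all of them. -/
theorem reduces_cups_cap {n : ℕ} (l : List ℕ) (j : ℕ) :
    ∃ k l₁ l₂, Reduces k (cups n l ++ [⟨Kind.cap, j⟩]) (caps n l₁ ++ cups n l₂) := by
  induction l using List.reverseRecOn generalizing j with
  | nil => exact ⟨0, [j], [], .refl _⟩
  | append_singleton l i ih =>
    have e : cups n (l ++ [i]) ++ [⟨Kind.cap, j⟩] =
        cups n l ++ [⟨Kind.cup, i⟩, ⟨Kind.cap, j⟩] := by simp [cups]
    rcases Reduces.cup_cap (n := n) i j with ⟨k, h⟩ | ⟨i', j', h⟩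
    · refine ⟨k, [], l, ?_⟩
      rw [e]
      simpa [caps] using h.append_left (cups n l)
    · obtain ⟨k, l₁, l₂, h'⟩ := ih j'
      refine ⟨0 + k, l₁, l₂ ++ [i'], ?_⟩
      rw [e]
      refine (h.append_left (cups n l)).trans ?_
      simpa [cups] using h'.append_right [⟨Kind.cup, i'⟩]

/-- A word without crossings and holes can be brought into a form with all maxima below all
minima. -/
theorem Plain.exists_reduces {n : ℕ} {w : List (Piece n)} (hw : Plain w) :
    ∃ k l₁ l₂, Reduces k w (caps n l₁ ++ cups n l₂) := by
  induction w using List.reverseRecOn with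
  | nil => exact ⟨0, [], [], .refl _⟩
  | append_singleton w p ih =>
    obtain ⟨k, l₁, l₂, h⟩ := ih fun q hq => hw q (List.mem_append_left _ hq)
    obtain ⟨kd, i⟩ := p
    have hp := hw ⟨kd, i⟩ (by simp)
    simp only at hp
    rcases hp with rfl | rfl
    · refine ⟨k, l₁, l₂ ++ [i], ?_⟩
      simpa [cups] using h.append_right [⟨Kind.cup, i⟩]
    · obtain ⟨k', l₁', l₂', h'⟩ := reduces_cups_cap (n := n) l₂ i
      refine ⟨k + k', l₁ ++ l₁', l₂', (h.append_right _).trans ?_⟩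
      simpa [caps] using h'.append_left (caps n l₁)

/-- In normal form each maximum uses up two strands and each minimum restores two, so two strands
leave room for at most one of each, at position 0. -/
theorem Plain.reduces_of_fits_two {n : ℕ} {w : List (Piece n)} (hw : Plain w) (h : Fits w 2 2) :
    ∃ k, Reduces k w [] ∨ Reduces k w [⟨Kind.cap, 0⟩, ⟨Kind.cup, 0⟩] := by
  obtain ⟨k, l₁, l₂, hr⟩ := hw.exists_reduces
  obtain ⟨b, h₁, h₂⟩ := fits_append_iff.1 (hr.fits h)
  have e₁ := fits_caps h₁
  have e₂ := fits_cups h₂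
  refine ⟨k, ?_⟩
  match l₁, l₂, e₁, e₂ with
  | [], [], _, _ => exact Or.inl hr
  | [i], [j], _, _ =>
    obtain ⟨r, h₁, h₁'⟩ := h₁
    obtain ⟨s, h₂, h₂'⟩ := h₂
    simp only [Kind.src, Kind.tgt, Fits, List.map_nil] at h₁ h₁' h₂
    obtain rfl : i = 0 := by omega
    obtain rfl : j = 0 := by omega
    exact Or.inr hr
  | [], _ :: _, _, _ => simp at *; omega
  | _ :: _, [], _, _ => simp at *; omega
  | [_], _ :: _ :: _, _, _ => simp at *; omega
  | _ :: _ :: _, _ :: _, _, _ => simp at *; omega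

/-! ## Matrix representations -/

/-- Insert the two values `a`, `b` at the places `i`, `i + 1` of a sequence. -/
def insertTwo (i : ℕ) (a b : Bool) (f : ℕ → Bool) : ℕ → Bool := fun x =>
  if x < i then f x else if x = i then a else if x = i + 1 then b else f (x - 2)

/-- Remove the values at the places `i`, `i + 1` of a sequence. -/
def removeTwo (i : ℕ) (f : ℕ → Bool) : ℕ → Bool := fun x => if x < i then f x else f (x + 2)

theorem removeTwo_insertTwo (i : ℕ) (a b : Bool) (f : ℕ → Bool) :
    removeTwo i (insertTwo i a b f) = f := by
  funext x; grind (splits := 20) [removeTwo, insertTwo]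

theorem removeTwo_succ_insertTwo (i : ℕ) (a b : Bool) (f : ℕ → Bool) :
    removeTwo (i + 1) (insertTwo i a b f) = Function.update f i a := by
  funext x; grind (splits := 20) [removeTwo, insertTwo, Function.update_apply]

theorem removeTwo_insertTwo_succ (i : ℕ) (a b : Bool) (f : ℕ → Bool) :
    removeTwo i (insertTwo (i + 1) a b f) = Function.update f i b := by
  funext x; grind (splits := 20) [removeTwo, insertTwo, Function.update_apply]

theorem insertTwo_insertTwo (i r : ℕ) (a b a' b' : Bool) (f : ℕ → Bool) :
    insertTwo (i + 2 + r) a b (insertTwo i a' b' f) =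
      insertTwo i a' b' (insertTwo (i + r) a b f) := by
  funext x; grind (splits := 20) [insertTwo]

theorem removeTwo_insertTwo_add (i r : ℕ) (a b : Bool) (f : ℕ → Bool) :
    removeTwo (i + 2 + r) (insertTwo i a b f) = insertTwo i a b (removeTwo (i + r) f) := by
  funext x; grind (splits := 20) [removeTwo, insertTwo]

theorem insertTwo_removeTwo (i r : ℕ) (a b : Bool) (f : ℕ → Bool) :
    insertTwo (i + r) a b (removeTwo i f) = removeTwo i (insertTwo (i + 2 + r) a b f) := by
  funext x; grind (splits := 20) [removeTwo, insertTwo]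

theorem removeTwo_removeTwo (i r : ℕ) (f : ℕ → Bool) :
    removeTwo (i + r) (removeTwo i f) = removeTwo i (removeTwo (i + 2 + r) f) := by
  funext x; grind (splits := 20) [removeTwo]

theorem insertTwo_self (i : ℕ) (a b : Bool) (f : ℕ → Bool) : insertTwo i a b f i = a := by
  simp [insertTwo]

theorem insertTwo_succ (i : ℕ) (a b : Bool) (f : ℕ → Bool) : insertTwo i a b f (i + 1) = b := by
  simp [insertTwo]

theorem insertTwo_of_lt {i x : ℕ} (h : x < i) (a b : Bool) (f : ℕ → Bool) :
    insertTwo i a b f x = f x := by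
  simp [insertTwo, h]

theorem insertTwo_add (i x : ℕ) (a b : Bool) (f : ℕ → Bool) :
    insertTwo i a b f (i + 2 + x) = f (i + x) := by
  grind [insertTwo]

theorem removeTwo_of_lt {i x : ℕ} (h : x < i) (f : ℕ → Bool) : removeTwo i f x = f x := by
  simp [removeTwo, h]

theorem removeTwo_add (i x : ℕ) (f : ℕ → Bool) : removeTwo i f (i + x) = f (i + 2 + x) := by
  grind [removeTwo]

section MatrixRep

variable {R : Type} [CommRing R]

/-- The Temperley-Lieb representation on tensors, where minima and maxima are given by two mutually
inverse matrices. -/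
def matrixRep (M N : Matrix Bool Bool R) (hMN : M * N = 1) (hNM : N * M = 1) :
    TLRep R (Module.End R ((ℕ → Bool) → R)) (∑ a, ∑ b, M a b * N a b) where
  -- Operators turn functions of the colours above a piece into functions of the colours below it,
  -- so products run from bottom to top. Sequences are infinite, so no strand count is needed.
  cup i :=
    { toFun := fun φ f => ∑ a, ∑ b, M a b * φ (insertTwo i a b f)
      map_add' := fun φ ψ => by
        funext f; simp only [Pi.add_apply, mul_add, Finset.sum_add_distrib]
      map_smul' := fun r φ => by
        funext f
        simp only [Pi.smul_apply, smul_eq_mul, Finset.mul_sum, RingHom.id_apply]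
        exact Finset.sum_congr rfl fun a _ => Finset.sum_congr rfl fun b _ => by ring }
  cap i :=
    { toFun := fun φ f => N (f i) (f (i + 1)) * φ (removeTwo i f)
      map_add' := fun φ ψ => by funext f; simp only [Pi.add_apply, mul_add]
      map_smul' := fun r φ => by
        funext f; simp only [Pi.smul_apply, smul_eq_mul, RingHom.id_apply]; ring }
  zigzag_left i := by
    refine LinearMap.ext fun φ => funext fun f => ?_
    have key : ∀ a, ∑ b, M a b * N b (f i) = (1 : Matrix Bool Bool R) a (f i) := fun a => by
      rw [← hMN, Matrix.mul_apply]
    calc ∑ a, ∑ b, M a b * (N (insertTwo i a b f (i + 1)) (insertTwo i a b f (i + 2)) *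
            φ (removeTwo (i + 1) (insertTwo i a b f))) =
          ∑ a, (∑ b, M a b * N b (f i)) * φ (Function.update f i a) := by
          refine Finset.sum_congr rfl fun a _ => ?_
          rw [Finset.sum_mul]
          refine Finset.sum_congr rfl fun b _ => ?_
          have e := insertTwo_add i 0 a b f
          simp only [add_zero] at e
          rw [insertTwo_succ, e, removeTwo_succ_insertTwo, mul_assoc]
      _ = φ f := by simp [key, Matrix.one_apply, -Fintype.univ_bool]
  zigzag_right i := by
    refine LinearMap.ext fun φ => funext fun f => ?_
    have key : ∀ b, ∑ a, N (f i) a * M a b = (1 : Matrix Bool Bool R) (f i) b := fun b => by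
      rw [← hNM, Matrix.mul_apply]
    calc ∑ a, ∑ b, M a b * (N (insertTwo (i + 1) a b f i) (insertTwo (i + 1) a b f (i + 1)) *
            φ (removeTwo i (insertTwo (i + 1) a b f))) =
          ∑ a, ∑ b, N (f i) a * M a b * φ (Function.update f i b) := by
          refine Finset.sum_congr rfl fun a _ => Finset.sum_congr rfl fun b _ => ?_
          rw [insertTwo_of_lt (Nat.lt_succ_self i), insertTwo_self, removeTwo_insertTwo_succ]
          ring
      _ = φ f := by
          rw [Finset.sum_comm]
          simp [← Finset.sum_mul, key, Matrix.one_apply, -Fintype.univ_bool]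
  loop i := by
    refine LinearMap.ext fun φ => funext fun f => ?_
    change ∑ a, ∑ b, M a b * (N (insertTwo i a b f i) (insertTwo i a b f (i + 1)) *
      φ (removeTwo i (insertTwo i a b f))) = (∑ a, ∑ b, M a b * N a b) * φ f
    simp only [insertTwo_self, insertTwo_succ, removeTwo_insertTwo, Finset.sum_mul, mul_assoc]
  cup_cup i r := by
    refine LinearMap.ext fun φ => funext fun f => ?_
    change ∑ a, ∑ b, M a b * (∑ a', ∑ b', M a' b' *
        φ (insertTwo (i + 2 + r) a' b' (insertTwo i a b f))) =
      ∑ a, ∑ b, M a b * (∑ a', ∑ b', M a' b' * φ (insertTwo i a' b' (insertTwo (i + r) a b f)))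
    simp only [insertTwo_insertTwo, Fintype.sum_bool]
    ring
  cup_cap i r := by
    refine LinearMap.ext fun φ => funext fun f => ?_
    change ∑ a, ∑ b, M a b *
      (N (insertTwo i a b f (i + 2 + r)) (insertTwo i a b f (i + 2 + (r + 1))) *
        φ (removeTwo (i + 2 + r) (insertTwo i a b f))) =
      N (f (i + r)) (f (i + (r + 1))) *
        ∑ a, ∑ b, M a b * φ (insertTwo i a b (removeTwo (i + r) f))
    simp only [insertTwo_add, removeTwo_insertTwo_add, Fintype.sum_bool]
    ring
  cap_cup i r := by
    refine LinearMap.ext fun φ => funext fun f => ?_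
    change N (f i) (f (i + 1)) * ∑ a, ∑ b, M a b * φ (insertTwo (i + r) a b (removeTwo i f)) =
      ∑ a, ∑ b, M a b * (N (insertTwo (i + 2 + r) a b f i) (insertTwo (i + 2 + r) a b f (i + 1)) *
        φ (removeTwo i (insertTwo (i + 2 + r) a b f)))
    simp only [insertTwo_of_lt (show i < i + 2 + r by omega),
      insertTwo_of_lt (show i + 1 < i + 2 + r by omega), insertTwo_removeTwo, Fintype.sum_bool]
    ring
  cap_cap i r := by
    refine LinearMap.ext fun φ => funext fun f => ?_
    change N (f i) (f (i + 1)) * (N (removeTwo i f (i + r)) (removeTwo i f (i + (r + 1))) *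
        φ (removeTwo (i + r) (removeTwo i f))) =
      N (f (i + 2 + r)) (f (i + 2 + (r + 1))) * (N (removeTwo (i + 2 + r) f i)
        (removeTwo (i + 2 + r) f (i + 1)) * φ (removeTwo i (removeTwo (i + 2 + r) f)))
    simp only [removeTwo_add, removeTwo_of_lt (show i < i + 2 + r by omega),
      removeTwo_of_lt (show i + 1 < i + 2 + r by omega), removeTwo_removeTwo]
    ring

theorem matrixRep_cup_apply (M N : Matrix Bool Bool R) (hMN : M * N = 1) (hNM : N * M = 1)
    (i : ℕ) (φ : (ℕ → Bool) → R) (f : ℕ → Bool) :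
    (matrixRep M N hMN hNM).cup i φ f = ∑ a, ∑ b, M a b * φ (insertTwo i a b f) := rfl

theorem matrixRep_cap_apply (M N : Matrix Bool Bool R) (hMN : M * N = 1) (hNM : N * M = 1)
    (i : ℕ) (φ : (ℕ → Bool) → R) (f : ℕ → Bool) :
    (matrixRep M N hMN hNM).cap i φ f = N (f i) (f (i + 1)) * φ (removeTwo i f) := rfl

end MatrixRep

/-! ## Colourings -/

variable {n : ℕ}

/-- The colour sequences `f` below and `g` above a layer agree along all its arcs. -/
structure Compatible (p : Piece n) (f g : ℕ → Bool) : Prop where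
  left : ∀ x < p.left, f x = g x
  right : ∀ x, f (p.left + p.kind.src + x) = g (p.left + p.kind.tgt + x)
  cup : p.kind = Kind.cup → g p.left = g (p.left + 1)
  cap : p.kind = Kind.cap → f p.left = f (p.left + 1)

/-- The colourings of a word with the colours `f` at the bottom. -/
structure IsColouring (w : List (Piece n)) (f : ℕ → Bool) (c : ℕ → ℕ → Bool) : Prop where
  bottom : c 0 = f
  compatible : ∀ l p, w[l]? = some p → Compatible p (c l) (c (l + 1))
  -- A default above the diagram, so that each colouring is counted once.
  top : ∀ l > w.length, c l = fun _ => false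

theorem compatible_cup_iff {i : ℕ} {f g : ℕ → Bool} :
    Compatible (n := n) ⟨Kind.cup, i⟩ f g ↔ ∃ a, g = insertTwo i a a f := by
  constructor
  · rintro ⟨h₁, h₂, h₃, -⟩
    simp only [Kind.src, Kind.tgt, add_zero, forall_const] at h₁ h₂ h₃
    refine ⟨g i, funext fun x => ?_⟩
    rcases lt_or_ge x i with h | h
    · rw [insertTwo_of_lt h, h₁ x h]
    · obtain ⟨y, rfl⟩ := Nat.exists_eq_add_of_le h
      match y with
      | 0 => exact (insertTwo_self _ _ _ _).symm
      | 1 => rw [insertTwo_succ, h₃]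
      | y + 2 =>
        rw [show i + (y + 2) = i + 2 + y by ring, insertTwo_add, h₂]
  · rintro ⟨a, rfl⟩
    refine ⟨fun x hx => (insertTwo_of_lt hx _ _ _).symm, fun x => (insertTwo_add _ _ _ _ _).symm,
      fun _ => ?_, fun h => by simp at h⟩
    simp only [insertTwo_self, insertTwo_succ]

theorem compatible_cap_iff {i : ℕ} {f g : ℕ → Bool} :
    Compatible (n := n) ⟨Kind.cap, i⟩ f g ↔ f i = f (i + 1) ∧ g = removeTwo i f := by
  constructor
  · rintro ⟨h₁, h₂, -, h₃⟩
    simp only [Kind.src, Kind.tgt, add_zero, forall_const] at h₁ h₂ h₃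
    refine ⟨h₃, funext fun x => ?_⟩
    rcases lt_or_ge x i with h | h
    · rw [removeTwo_of_lt h, h₁ x h]
    · obtain ⟨y, rfl⟩ := Nat.exists_eq_add_of_le h
      rw [removeTwo_add, h₂]
  · rintro ⟨h, rfl⟩
    exact ⟨fun x hx => (removeTwo_of_lt hx _).symm, fun x => (removeTwo_add _ _ _).symm,
      fun h => by simp at h, fun _ => h⟩

/-- A colouring of a word consists of the colours above the first layer and a colouring of the
remaining word. -/
def colouringConsEquiv (p : Piece n) (w : List (Piece n)) (f : ℕ → Bool) :
    {c // IsColouring (p :: w) f c} ≃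
      Σ g : {g // Compatible p f g}, {c // IsColouring w g.1 c} where
  toFun c := ⟨⟨c.1 1, by have := c.2.compatible 0 p rfl; rwa [c.2.bottom] at this⟩,
    ⟨fun l => c.1 (l + 1), rfl, fun l q h => c.2.compatible (l + 1) q h,
      fun l h => c.2.top (l + 1) (Nat.succ_lt_succ h)⟩⟩
  invFun c := ⟨fun l => Nat.casesOn l f c.2.1, rfl, fun l q h => by
      cases l with
      | zero =>
        obtain rfl : p = q := by simpa using h
        have := c.1.2
        rwa [← c.2.2.bottom] at this
      | succ l => exact c.2.2.compatible l q h, fun l h => by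
      cases l with
      | zero => simp at h
      | succ l => exact c.2.2.top l (Nat.lt_of_succ_lt_succ h)⟩
  left_inv c := by
    refine Subtype.ext (funext fun l => ?_)
    cases l with
    | zero => exact c.2.bottom.symm
    | succ l => rfl
  right_inv := by
    rintro ⟨⟨g, hg⟩, ⟨c, hc⟩⟩
    obtain rfl := hc.bottom
    rfl

theorem isColouring_nil_iff {f : ℕ → Bool} {c : ℕ → ℕ → Bool} :
    IsColouring ([] : List (Piece n)) f c ↔ c = fun l => Nat.casesOn l f fun _ _ => false := by
  constructor
  · rintro ⟨h₁, -, h₂⟩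
    funext l
    cases l with
    | zero => exact h₁
    | succ l => exact h₂ _ (Nat.succ_pos l)
  · rintro rfl
    refine ⟨rfl, fun l p h => by simp at h, fun l h => ?_⟩
    cases l with
    | zero => simp at h
    | succ l => rfl

theorem finite_compatible {p : Piece n} (hp : p.kind = Kind.cup ∨ p.kind = Kind.cap)
    (f : ℕ → Bool) : Finite {g // Compatible p f g} := by
  obtain ⟨k, i⟩ := p
  rcases hp with h | h <;> obtain rfl := h
  · simp only [compatible_cup_iff]
    exact Set.Finite.to_subtype ((Set.finite_range fun a => insertTwo i a a f).subset
      fun g ⟨a, h⟩ => ⟨a, h.symm⟩)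
  · simp only [compatible_cap_iff]
    exact Set.Finite.to_subtype ((Set.finite_singleton (removeTwo i f)).subset fun g h => h.2)

/-- With identity matrices a minimum sums over the one free colour of its arc, and a maximum tests
whether its two ends have equal colours. -/
theorem kindVal_eq_sum {p : Piece n} (hp : p.kind = Kind.cup ∨ p.kind = Kind.cap)
    (x : Bool → Fin 2 → ℤ) (c : Fin n → Fin 2 → ℤ) (f : ℕ → Bool)
    [Fintype {g // Compatible p f g}] (φ : (ℕ → Bool) → ℤ) :
    (matrixRep (1 : Matrix Bool Bool ℤ) 1 (mul_one 1) (mul_one 1)).kindVal x c p.kind p.left φ f =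
      ∑ g : {g // Compatible p f g}, φ g.1 := by
  obtain ⟨k, i⟩ := p
  rcases hp with h | h <;> obtain rfl := h
  · simp only [TLRep.kindVal, matrixRep_cup_apply]
    have e : Function.Bijective fun a : Bool =>
        (⟨insertTwo i a a f, compatible_cup_iff.2 ⟨a, rfl⟩⟩ : {g // Compatible (n := n) ⟨Kind.cup, i⟩ f g}) := by
      refine ⟨fun a b h => ?_, fun g => ?_⟩
      · simpa [insertTwo_self] using congrFun (congrArg Subtype.val h) i
      · obtain ⟨a, h⟩ := compatible_cup_iff.1 g.2
        exact ⟨a, Subtype.ext h.symm⟩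
    rw [← e.sum_comp (fun g => φ g.1)]
    simp
  · simp only [TLRep.kindVal, matrixRep_cap_apply]
    by_cases h : f i = f (i + 1)
    · have e : (Finset.univ : Finset {g // Compatible (n := n) ⟨Kind.cap, i⟩ f g}) =
          {⟨removeTwo i f, compatible_cap_iff.2 ⟨h, rfl⟩⟩} :=
        Finset.eq_singleton_iff_unique_mem.2
          ⟨Finset.mem_univ _, fun g _ => Subtype.ext (compatible_cap_iff.1 g.2).2⟩
      have h' : (1 : Matrix Bool Bool ℤ) (f i) (f (i + 1)) = 1 := by rw [h, Matrix.one_apply_eq]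
      rw [e, Finset.sum_singleton, h', one_mul]
    · have : IsEmpty {g // Compatible (n := n) ⟨Kind.cap, i⟩ f g} :=
        ⟨fun g => h (compatible_cap_iff.1 g.2).1⟩
      rw [Matrix.one_apply_ne h, zero_mul, Finset.univ_eq_empty, Finset.sum_empty]

/-- The representation with loop value two counts colourings with two colours. -/
theorem Plain.card_colourings {w : List (Piece n)} (hw : Plain w) (x : Bool → Fin 2 → ℤ)
    (c : Fin n → Fin 2 → ℤ) (f : ℕ → Bool) :
    Finite {c // IsColouring w f c} ∧
      (matrixRep (1 : Matrix Bool Bool ℤ) 1 (mul_one 1) (mul_one 1)).val x c w (fun _ => 1) f =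
        Nat.card {c // IsColouring w f c} := by
  induction w generalizing f with
  | nil =>
    simp only [isColouring_nil_iff]
    exact ⟨inferInstance, by rw [TLRep.val_nil]; simp⟩
  | cons p w ih =>
    have ih' := ih fun q hq => hw q (List.mem_cons_of_mem _ hq)
    have hp := hw p List.mem_cons_self
    have := finite_compatible hp f
    have := Fintype.ofFinite {g // Compatible p f g}
    have : ∀ g : {g // Compatible p f g}, Finite {c // IsColouring w g.1 c} := fun g => (ih' g.1).1
    refine ⟨Finite.of_equiv _ (colouringConsEquiv p w f).symm, ?_⟩
    rw [Nat.card_congr (colouringConsEquiv p w f), Nat.card_sigma, TLRep.val_cons,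
      Module.End.mul_apply, kindVal_eq_sum hp]
    push_cast
    exact Finset.sum_congr rfl fun g _ => (ih' g.1).2

/-! ### Colourings of a closed diagram and its circles. -/

/-- For a word that fits, the truncated subtraction in the strand count never truncates. -/
theorem exists_foldl_take {w : List (Piece n)} {a b : ℕ} (h : Fits w a b) {l : ℕ} {p : Piece n}
    (hp : w[l]? = some p) :
    ∃ r, (w.take l).foldl (fun c p => c + p.kind.tgt - p.kind.src) a = p.left + p.kind.src + r ∧
      (w.take (l + 1)).foldl (fun c p => c + p.kind.tgt - p.kind.src) a =
        p.left + p.kind.tgt + r := by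
  induction w generalizing a l with
  | nil => simp at hp
  | cons q w ih =>
    obtain ⟨r, e, h⟩ := h
    cases l with
    | zero =>
      obtain rfl : q = p := by simpa using hp
      exact ⟨r, e, by simp; omega⟩
    | succ l =>
      have e' : a + q.kind.tgt - q.kind.src = q.left + q.kind.tgt + r := by omega
      simpa [e'] using ih h (by simpa using hp)

/-- Ensures that `Nat.card` in the definition of `circles` is a true count and not the default 0. -/
instance finite_point (w : List (Piece n)) : Finite (Point w) := by
  refine Finite.of_injective (β := Σ l : Fin (w.length + 1), Fin (levelWidth w l))
    (fun q => ⟨⟨q.1.1, Nat.lt_succ_of_le q.2.1⟩, ⟨q.1.2, q.2.2⟩⟩) ?_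
  rintro ⟨⟨l, x⟩, h⟩ ⟨⟨l', x'⟩, h'⟩ e
  simp only [Sigma.mk.injEq, Fin.mk.injEq] at e
  obtain ⟨rfl, e⟩ := e
  simpa using e

theorem IsColouring.eq_of_joined {w : List (Piece n)} {f : ℕ → Bool} {c : ℕ → ℕ → Bool}
    (hc : IsColouring w f c) {p q : ℕ × ℕ} (h : Joined w p q) : c p.1 p.2 = c q.1 q.2 := by
  cases h with
  | left l x p hp hx => exact (hc.compatible l p hp).left x hx
  | right l x p hp => exact (hc.compatible l p hp).right x
  | cup l i hp => exact (hc.compatible l _ hp).cup rfl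
  | cap l i hp => exact (hc.compatible l _ hp).cap rfl

/-- The fictitious strands to the right of the diagram run down to the bottom line, so they
contribute no freedom to the colouring. -/
theorem IsColouring.eq_false {w : List (Piece n)} {b : ℕ} (hw : Fits w 0 b) {c : ℕ → ℕ → Bool}
    (hc : IsColouring w (fun _ => false) c) {l x : ℕ} (hx : levelWidth w l ≤ x) :
    c l x = false := by
  induction l generalizing x with
  | zero => rw [hc.bottom]
  | succ l ih =>
    by_cases hl : l < w.length
    · obtain ⟨r, h₁, h₂⟩ := exists_foldl_take hw (List.getElem?_eq_getElem hl)
      have := (hc.compatible l _ (List.getElem?_eq_getElem hl)).right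
      change levelWidth w l = _ at h₁
      change levelWidth w (l + 1) = _ at h₂
      obtain ⟨y, rfl⟩ := Nat.exists_eq_add_of_le hx
      rw [h₂, add_assoc, ← this]
      exact ih (by omega)
    · rw [hc.top _ (by omega)]

open Classical in
/-- The colourings of a closed diagram are the colourings of its circles. -/
noncomputable def colouringEquiv {w : List (Piece n)} {b : ℕ} (hw : Fits w 0 b) :
    {c // IsColouring w (fun _ => false) c} ≃
      (Quot (fun p q : Point w => Joined w p.1 q.1) → Bool) where
  toFun c := Quot.lift (fun p => c.1 p.1.1 p.1.2) fun _ _ h => c.2.eq_of_joined h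
  invFun χ := ⟨fun l x => if h : l ≤ w.length ∧ x < levelWidth w l then
      χ (Quot.mk _ ⟨(l, x), h⟩) else false, by
    refine ⟨funext fun x => dif_neg (by simp [levelWidth]), fun l p hp => ?_,
      fun l h => funext fun x => dif_neg fun h' => absurd h'.1 (by omega)⟩
    have hl : l < w.length := (List.getElem?_eq_some_iff.1 hp).1
    obtain ⟨r, h₁, h₂⟩ := exists_foldl_take hw hp
    change levelWidth w l = _ at h₁
    change levelWidth w (l + 1) = _ at h₂
    have key : ∀ (q q' : ℕ × ℕ) (h : q.1 ≤ w.length ∧ q.2 < levelWidth w q.1)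
        (h' : q'.1 ≤ w.length ∧ q'.2 < levelWidth w q'.1), Joined w q q' →
        (if h : q.1 ≤ w.length ∧ q.2 < levelWidth w q.1 then
          χ (Quot.mk _ ⟨(q.1, q.2), h⟩) else false) =
        if h : q'.1 ≤ w.length ∧ q'.2 < levelWidth w q'.1 then
          χ (Quot.mk _ ⟨(q'.1, q'.2), h⟩) else false := by
      intro q q' h h' hj
      rw [dif_pos h, dif_pos h']
      exact congrArg χ (Quot.sound hj)
    refine ⟨fun x hx => ?_, fun x => ?_, fun h => ?_, fun h => ?_⟩
    · exact key (l, x) (l + 1, x) ⟨hl.le, by simp only; omega⟩ ⟨hl, by simp only; omega⟩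
        (.left l x p hp hx)
    · by_cases hx : x < r
      · exact key (l, p.left + p.kind.src + x) (l + 1, p.left + p.kind.tgt + x)
          ⟨hl.le, by simp only; omega⟩ ⟨hl, by simp only; omega⟩ (.right l x p hp)
      · rw [dif_neg (by omega), dif_neg (by omega)]
    · obtain ⟨k, i⟩ := p
      obtain rfl := h
      simp only [Kind.tgt] at h₂
      exact key (l + 1, i) (l + 1, i + 1) ⟨hl, by simp only; omega⟩ ⟨hl, by simp only; omega⟩
        (.cup l i hp)
    · obtain ⟨k, i⟩ := p
      obtain rfl := h
      simp only [Kind.src] at h₁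
      exact key (l, i) (l, i + 1) ⟨hl.le, by simp only; omega⟩ ⟨hl.le, by simp only; omega⟩
        (.cap l i hp)⟩
  left_inv c := by
    refine Subtype.ext (funext fun l => funext fun x => ?_)
    by_cases h : l ≤ w.length ∧ x < levelWidth w l
    · exact dif_pos h
    · refine (dif_neg h).trans ?_
      by_cases hl : l ≤ w.length
      · exact (c.2.eq_false hw (not_lt.1 fun h' => h ⟨hl, h'⟩)).symm
      · rw [c.2.top l (not_le.1 hl)]
  right_inv χ := by
    refine funext fun q => ?_
    induction q using Quot.ind with
    | mk q => exact dif_pos q.2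

/-- If a closed diagram has the value `d ^ k` in all Temperley-Lieb representations, then it has
`k` circles. -/
theorem Plain.circles_eq {w : List (Piece n)} (hw : Plain w) (h : Fits w 0 0) {k : ℕ}
    (hk : ∀ {R E : Type} [CommRing R] [Ring E] [Algebra R E] {d : R} (ρ : TLRep R E d)
      (x : Bool → Fin 2 → R) (c : Fin n → Fin 2 → R), ρ.val x c w = d ^ k • 1) :
    circles w = k := by
  -- At loop value 2 the value of the word is `2 ^ k`, and it counts the two-colourings, of which
  -- there are `2 ^ circles w`.
  have h₁ := (hw.card_colourings 0 0 fun _ => false).2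
  have h₂ : ∑ a, ∑ b, (1 : Matrix Bool Bool ℤ) a b * (1 : Matrix Bool Bool ℤ) a b = 2 := by
    decide
  rw [hk, Nat.card_congr (colouringEquiv h), Nat.card_fun, h₂, LinearMap.smul_apply,
    Module.End.one_apply, Pi.smul_apply, smul_eq_mul, mul_one] at h₁
  have h₃ : (2 : ℤ) ^ k = 2 ^ circles w := by
    simpa [circles] using h₁
  exact (Nat.pow_right_injective le_rfl (by exact_mod_cast h₃)).symm

/-! ## State sums -/

section StateSum

variable {V : Type} [AddCommMonoid V] [Module ℂ V]

/-- The sum of the values of `φ` at the resolutions of a word, weighted as in the Kauffman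
bracket. -/
noncomputable def stateSum (A : ℂ) : List (Piece 0) → (List (Piece 0) → V) → V
  | [], φ => φ []
  | p :: w, φ =>
    if p.kind.isCrossing = true then
      A • stateSum A w (fun v => φ (p.split Splitting.A ++ v)) +
        A⁻¹ • stateSum A w (fun v => φ (p.split Splitting.B ++ v))
    else stateSum A w (fun v => φ (p :: v))

/-- The weight of a splitting. -/
noncomputable def Splitting.weight (A : ℂ) : Splitting → ℂ
  | Splitting.A => A
  | Splitting.B => A⁻¹

theorem sum_splitting {V : Type} [AddCommMonoid V] (f : Splitting → V) :
    ∑ s, f s = f Splitting.A + f Splitting.B := by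
  change ∑ s ∈ {Splitting.A, Splitting.B}, f s = _
  rw [Finset.sum_pair (by simp)]

theorem prod_weight {w : List (Piece 0)} (A : ℂ) (σ : State w) :
    A ^ (Finset.univ.filter fun c => σ c = Splitting.A).card *
      A⁻¹ ^ (Finset.univ.filter fun c => σ c = Splitting.B).card = ∏ c, (σ c).weight A := by
  have h : ∀ c, (σ c).weight A =
      (if σ c = Splitting.A then A else 1) * if σ c = Splitting.B then A⁻¹ else 1 := fun c => by
    cases σ c <;> simp [Splitting.weight]
  simp_rw [h, Finset.prod_mul_distrib, Finset.prod_ite, Finset.prod_const_one, mul_one,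
    Finset.prod_const]

/-- The crossings of a word that starts with a crossing. -/
noncomputable def crossingConsOption {p : Piece 0} (hp : p.kind.isCrossing = true)
    (w : List (Piece 0)) : Option (Crossing w) ≃ Crossing (p :: w) :=
  Equiv.ofBijective (fun o => o.elim ⟨⟨0, Nat.succ_pos _⟩, hp⟩ fun c => ⟨c.1.succ, c.2⟩) <| by
    constructor
    · rintro (_ | ⟨c, hc⟩) (_ | ⟨c', hc'⟩) h
      · rfl
      · simp [Fin.ext_iff] at h
      · simp [Fin.ext_iff] at h
      · simpa [Fin.ext_iff] using h
    · rintro ⟨⟨l, hl⟩, h⟩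
      cases l with
      | zero => exact ⟨none, rfl⟩
      | succ l => exact ⟨some ⟨⟨l, Nat.lt_of_succ_lt_succ hl⟩, h⟩, rfl⟩

/-- The crossings of a word that does not start with a crossing. -/
noncomputable def crossingCons {p : Piece 0} (hp : ¬ p.kind.isCrossing = true)
    (w : List (Piece 0)) : Crossing w ≃ Crossing (p :: w) :=
  Equiv.ofBijective (fun c => ⟨c.1.succ, c.2⟩) <| by
    constructor
    · rintro ⟨c, hc⟩ ⟨c', hc'⟩ h
      simpa [Fin.ext_iff] using h
    · rintro ⟨⟨l, hl⟩, h⟩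
      cases l with
      | zero => exact absurd h hp
      | succ l => exact ⟨⟨⟨l, Nat.lt_of_succ_lt_succ hl⟩, h⟩, rfl⟩

theorem resolve_cons (p : Piece 0) (w : List (Piece 0)) (σ : State (p :: w)) :
    resolve (p :: w) σ =
      (if h : p.kind.isCrossing = true then p.split (σ ⟨⟨0, Nat.succ_pos _⟩, h⟩) else [p]) ++
        resolve w fun c => σ ⟨c.1.succ, c.2⟩ := by
  simp only [resolve, List.length_cons, List.ofFn_succ, List.flatten_cons]
  rfl

/-- If the bottom piece is a crossing, a state is a splitting of it together with a state of the
rest; otherwise it is just a state of the rest. -/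
theorem sum_states (A : ℂ) (w : List (Piece 0)) (φ : List (Piece 0) → V) :
    ∑ σ : State w, (∏ c, (σ c).weight A) • φ (resolve w σ) = stateSum A w φ := by
  induction w generalizing φ with
  | nil =>
    have : IsEmpty (Crossing []) := ⟨fun c => c.1.elim0⟩
    simp [stateSum, resolve]
  | cons p w ih =>
    by_cases hp : p.kind.isCrossing = true
    · rw [stateSum, if_pos hp, ← ih, ← ih,
        ← ((crossingConsOption hp w).arrowCongr (Equiv.refl Splitting)).sum_comp,
        ← (Equiv.piOptionEquivProd (β := fun _ => Splitting)).symm.sum_comp,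
        Fintype.sum_prod_type, sum_splitting, Finset.smul_sum, Finset.smul_sum]
      have key : ∀ (s : Splitting) (τ : State w),
          (∏ c, (((crossingConsOption hp w).arrowCongr (Equiv.refl Splitting))
            ((Equiv.piOptionEquivProd (β := fun _ => Splitting)).symm (s, τ)) c).weight A) •
            φ (resolve (p :: w) (((crossingConsOption hp w).arrowCongr (Equiv.refl Splitting))
            ((Equiv.piOptionEquivProd (β := fun _ => Splitting)).symm (s, τ)))) =
          s.weight A • (∏ c, (τ c).weight A) • φ (p.split s ++ resolve w τ) := by
        intro s τ
        set σ := ((crossingConsOption hp w).arrowCongr (Equiv.refl Splitting))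
            ((Equiv.piOptionEquivProd (β := fun _ => Splitting)).symm (s, τ)) with hσ
        have h₀ : ∀ o, σ (crossingConsOption hp w o) =
            (Equiv.piOptionEquivProd (β := fun _ => Splitting)).symm (s, τ) o := fun o => by
          rw [hσ, Equiv.arrowCongr_apply, Function.comp_apply, Function.comp_apply,
            Equiv.symm_apply_apply, Equiv.refl_apply]
        have h₁ : σ ⟨⟨0, Nat.succ_pos _⟩, hp⟩ = s := h₀ none
        have h₂ : ∀ c : Crossing w, σ ⟨c.1.succ, c.2⟩ = τ c := fun c => h₀ (some c)
        rw [resolve_cons, dif_pos hp, h₁, ← (crossingConsOption hp w).prod_comp,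
          Fintype.prod_option, smul_smul]
        simp only [h₂, h₀]
        rfl
      simp only [key]
      rfl
    · rw [stateSum, if_neg hp, ← ih,
        ← ((crossingCons hp w).arrowCongr (Equiv.refl Splitting)).sum_comp]
      refine Finset.sum_congr rfl fun τ _ => ?_
      have h₁ : ∀ c : Crossing w, ((crossingCons hp w).arrowCongr (Equiv.refl Splitting)) τ
          ⟨c.1.succ, c.2⟩ = τ c := fun c => by
        have : (crossingCons hp w).symm ⟨c.1.succ, c.2⟩ = c :=
          (Equiv.symm_apply_eq _).2 rfl
        simp [this]
      rw [resolve_cons, dif_neg hp, ← (crossingCons hp w).prod_comp]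
      simp only [h₁, List.singleton_append]
      congr 1
      exact Finset.prod_congr rfl fun c _ => congrArg _ (h₁ c)

theorem stateSum_append (A : ℂ) (u w : List (Piece 0)) (φ : List (Piece 0) → V) :
    stateSum A (u ++ w) φ = stateSum A u fun x => stateSum A w fun y => φ (x ++ y) := by
  induction u generalizing φ with
  | nil => rfl
  | cons p u ih => simp only [List.cons_append, stateSum, ih, List.append_assoc]

theorem split_shift (s : ℕ) (p : Piece 0) (σ : Splitting) :
    (Piece.mk p.kind (s + p.left)).split σ = shift s (p.split σ) := by
  obtain ⟨k, i⟩ := p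
  cases σ <;> rcases k with _ | _ | (_ | _) | _ <;> rfl

theorem stateSum_shift (A : ℂ) (s : ℕ) (w : List (Piece 0)) (φ : List (Piece 0) → V) :
    stateSum A (shift s w) φ = stateSum A w fun v => φ (shift s v) := by
  induction w generalizing φ with
  | nil => rfl
  | cons p w ih =>
    change stateSum A (⟨p.kind, s + p.left⟩ :: shift s w) φ = _
    simp only [stateSum, ih, split_shift]
    simp only [shift, List.map_append, List.map_cons]

theorem Plain.split {p : Piece 0} (hp : p.kind.isCrossing = true) (s : Splitting) :
    Plain (p.split s) := by
  obtain ⟨k, i⟩ := p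
  cases s <;> rcases k with _ | _ | (_ | _) | _ <;> simp [Plain, Piece.split, Kind.isCrossing] at *

theorem fits_split {p : Piece 0} (hp : p.kind.isCrossing = true) (s : Splitting) (r : ℕ) :
    Fits (p.split s) (p.left + p.kind.src + r) (p.left + p.kind.tgt + r) := by
  obtain ⟨k, i⟩ := p
  cases s <;> rcases k with _ | _ | (_ | _) | k <;>
    simp [Piece.split, Kind.isCrossing, Fits, Kind.src, Kind.tgt] at *

/-- Splitting a crossing keeps the numbers of strands, so all resolutions are crossingless words
with the ends of `w`. -/
theorem stateSum_congr (A : ℂ) {w : List (Piece 0)} {a b : ℕ} (hw : Fits w a b)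
    {φ ψ : List (Piece 0) → V} (h : ∀ v, Plain v → Fits v a b → φ v = ψ v) :
    stateSum A w φ = stateSum A w ψ := by
  induction w generalizing a φ ψ with
  | nil => exact h [] (fun p hp => by simp at hp) hw
  | cons p w ih =>
    obtain ⟨r, rfl, hw⟩ := hw
    simp only [stateSum]
    split_ifs with hp
    · rw [ih hw fun v hv hf => h _ ((Plain.split hp _).append hv) ((fits_split hp _ r).append hf),
        ih hw fun v hv hf => h _ ((Plain.split hp _).append hv) ((fits_split hp _ r).append hf)]
    · refine ih hw fun v hv hf => h _ ?_ ⟨r, rfl, hf⟩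
      intro q hq
      rcases List.mem_cons.1 hq with rfl | hq
      · obtain ⟨k, i⟩ := q
        rcases k with _ | _ | _ | k
        · exact Or.inl rfl
        · exact Or.inr rfl
        · exact absurd rfl hp
        · exact k.elim0
      · exact hv q hq

theorem stateSum_add (A : ℂ) (w : List (Piece 0)) (φ ψ : List (Piece 0) → V) :
    (stateSum A w fun v => φ v + ψ v) = stateSum A w φ + stateSum A w ψ := by
  induction w generalizing φ ψ with
  | nil => rfl
  | cons p w ih =>
    simp only [stateSum, ih, smul_add]
    split_ifs
    · exact add_add_add_comm _ _ _ _
    · rfl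

theorem stateSum_comp {W : Type} [AddCommMonoid W] [Module ℂ W] (A : ℂ) (w : List (Piece 0))
    (φ : List (Piece 0) → V) (f : V →ₗ[ℂ] W) :
    (stateSum A w fun v => f (φ v)) = f (stateSum A w φ) := by
  induction w generalizing φ with
  | nil => rfl
  | cons p w ih =>
    simp only [stateSum, ih]
    split_ifs <;> simp

end StateSum

theorem kauffmanBracket_eq_stateSum (A : ℂ) (L : LinkDiagram) :
    kauffmanBracket A L = stateSum A L.word fun v => (-A ^ 2 - A⁻¹ ^ 2) ^ (circles v - 1) := by
  rw [← sum_states, kauffmanBracket]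
  simp only [prod_weight, smul_eq_mul]

/-- Multiplying out the two-term values of the crossings is the state expansion. Resolutions contain
no crossings, so `x` may be arbitrary. -/
theorem TLRep.val_eq_stateSum {E : Type} [Ring E] [Algebra ℂ E] {d : ℂ} (ρ : TLRep ℂ E d) (A : ℂ)
    (x : Bool → Fin 2 → ℂ) (c : Fin 0 → Fin 2 → ℂ) (w : List (Piece 0)) :
    ρ.val (crossCoeff A A⁻¹) c w = stateSum A w (ρ.val x c) := by
  induction w with
  | nil => rfl
  | cons p w ih =>
    obtain ⟨k, i⟩ := p
    have comp := fun u : E => stateSum_comp A w (ρ.val x c) (LinearMap.mulLeft ℂ u)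
    simp only [LinearMap.mulLeft_apply] at comp
    simp only [stateSum, val_append, val_cons, comp, ih]
    rcases k with _ | _ | (_ | _) | k
    · rfl
    · rfl
    · simp [Kind.isCrossing, Piece.split, kindVal, crossCoeff, gen, add_mul, mul_assoc, add_comm]
    · simp [Kind.isCrossing, Piece.split, kindVal, crossCoeff, gen, add_mul, mul_assoc]
    · exact k.elim0

/-! ## The bracket of the closures of a ball tangle diagram -/

/-- The eighth root of unity at which the bracket is evaluated. -/
noncomputable def zeta : ℂ := Complex.exp (Complex.I * Real.pi / 4)

theorem zeta_sq : zeta ^ 2 = Complex.I := by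
  rw [zeta, ← Complex.exp_nat_mul]
  refine Eq.trans (congrArg _ ?_) Complex.exp_pi_div_two_mul_I
  push_cast
  ring

theorem closure_zero_word (B : TangleDiagram 0) :
    (closure B 0).word = [⟨Kind.cup, 0⟩] ++ B.word ++ [⟨Kind.cap, 0⟩] := rfl

theorem closure_one_word (B : TangleDiagram 0) :
    (closure B 1).word = [⟨Kind.cup, 0⟩, ⟨Kind.cup, 2⟩] ++ shift 1 B.word ++
      [⟨Kind.cap, 0⟩, ⟨Kind.cap, 0⟩] := rfl

/-- Besides its `k` removed circles, `v` is one of the two fundamental tangles; the closure that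
matches it adds one circle, the other closure two. -/
theorem circles_closures {v : List (Piece 0)} (hv : Plain v) (h : Fits v 2 2) :
    ∃ k, (Reduces k v [] ∧ circles ([⟨Kind.cup, 0⟩] ++ v ++ [⟨Kind.cap, 0⟩]) = k + 1 ∧
        circles ([⟨Kind.cup, 0⟩, ⟨Kind.cup, 2⟩] ++ shift 1 v ++ [⟨Kind.cap, 0⟩, ⟨Kind.cap, 0⟩]) =
          k + 2) ∨
      (Reduces k v [⟨Kind.cap, 0⟩, ⟨Kind.cup, 0⟩] ∧
        circles ([⟨Kind.cup, 0⟩] ++ v ++ [⟨Kind.cap, 0⟩]) = k + 2 ∧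
        circles ([⟨Kind.cup, 0⟩, ⟨Kind.cup, 2⟩] ++ shift 1 v ++ [⟨Kind.cap, 0⟩, ⟨Kind.cap, 0⟩]) =
          k + 1) := by
  have p₀ : Plain ([⟨Kind.cup, 0⟩] ++ v ++ [⟨Kind.cap, 0⟩]) := by
    refine (Plain.append ?_ hv).append ?_ <;> simp [Plain]
  have p₁ : Plain ([⟨Kind.cup, 0⟩, ⟨Kind.cup, 2⟩] ++ shift 1 v ++
      [⟨Kind.cap, 0⟩, ⟨Kind.cap, 0⟩]) := by
    refine (Plain.append ?_ (hv.shift 1)).append ?_ <;> simp [Plain]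
  have f₀ := (closure ⟨v, h, fun k => k.elim0⟩ 0).fits
  have f₁ := (closure ⟨v, h, fun k => k.elim0⟩ 1).fits
  rw [closure_zero_word] at f₀
  rw [closure_one_word] at f₁
  obtain ⟨k, hk | hk⟩ := hv.reduces_of_fits_two h
  · refine ⟨k, Or.inl ⟨hk, p₀.circles_eq f₀ fun ρ x c => ?_, p₁.circles_eq f₁ fun ρ x c => ?_⟩⟩
    · simp [hk.val, TLRep.kindVal, ρ.loop, smul_smul, pow_succ]
    -- This exchange separates the two nested factors into two loops.
    · have e := ρ.cap_cup 0 0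
      simp only [add_zero, zero_add] at e
      simp [TLRep.val_shift, hk.val, TLRep.kindVal]
      rw [← mul_assoc (ρ.cup 2), ← e, mul_assoc, ρ.loop, mul_smul_comm, mul_one, mul_smul_comm,
        ρ.loop, smul_smul, smul_smul]
      ring_nf
  · refine ⟨k, Or.inr ⟨hk, p₀.circles_eq f₀ fun ρ x c => ?_, p₁.circles_eq f₁ fun ρ x c => ?_⟩⟩
    · simp [hk.val, TLRep.kindVal, mul_assoc, ρ.loop]
      simp [smul_smul]
      ring_nf
    -- Two zigzags straighten, and one loop remains.
    · have e := ρ.zigzag_right 0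
      have e' := ρ.zigzag_right 1
      simp only [zero_add, Nat.reduceAdd] at e e'
      simp [TLRep.val_shift, hk.val, TLRep.kindVal, TLRep.shiftBy, mul_assoc]
      rw [← mul_assoc (ρ.cup 1), e, one_mul, ← mul_assoc (ρ.cup 2), e', one_mul, ρ.loop, smul_smul]
      ring_nf

/-- The two brackets of a ball tangle diagram are its coefficients in the Temperley-Lieb algebra. -/
theorem TLRep.val_eq_bracket {E : Type} [Ring E] [Algebra ℂ E] (ρ : TLRep ℂ E 0)
    (c : Fin 0 → Fin 2 → ℂ) (B : TangleDiagram 0) :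
    ρ.val (crossCoeff zeta zeta⁻¹) c B.word =
      bracket (closure B 0) • 1 + bracket (closure B 1) • ρ.gen 0 := by
  have hz : -zeta ^ 2 - zeta⁻¹ ^ 2 = 0 := by rw [inv_pow, zeta_sq]; simp
  have hb : ∀ L, bracket L = stateSum zeta L.word fun v => (0 : ℂ) ^ (circles v - 1) := fun L => by
    rw [bracket, kauffmanBracket_eq_stateSum, ← zeta]
    simp only [hz]
  rw [ρ.val_eq_stateSum zeta 0, hb, hb, closure_zero_word, closure_one_word]
  have e₀ : ∀ φ : List (Piece 0) → ℂ,
      stateSum zeta ([⟨Kind.cup, 0⟩] ++ B.word ++ [⟨Kind.cap, 0⟩]) φ =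
        stateSum zeta B.word fun v => φ ([⟨Kind.cup, 0⟩] ++ v ++ [⟨Kind.cap, 0⟩]) := fun φ => by
    simp [stateSum_append, stateSum, Kind.isCrossing]
  have e₁ : ∀ φ : List (Piece 0) → ℂ,
      stateSum zeta ([⟨Kind.cup, 0⟩, ⟨Kind.cup, 2⟩] ++ BallTangle.shift 1 B.word ++
        [⟨Kind.cap, 0⟩, ⟨Kind.cap, 0⟩]) φ =
        stateSum zeta B.word fun v => φ ([⟨Kind.cup, 0⟩, ⟨Kind.cup, 2⟩] ++ BallTangle.shift 1 v ++
          [⟨Kind.cap, 0⟩, ⟨Kind.cap, 0⟩]) := fun φ => by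
    simp [stateSum_append, stateSum, stateSum_shift, Kind.isCrossing]
  rw [e₀, e₁]
  have s := fun (u : E) (φ : List (Piece 0) → ℂ) =>
    stateSum_comp zeta B.word φ (LinearMap.toSpanSingleton ℂ E u)
  simp only [LinearMap.toSpanSingleton_apply] at s
  rw [← s, ← s, ← stateSum_add]
  refine stateSum_congr zeta B.fits fun v hv hf => ?_
  -- The matching closure contributes `0 ^ k`, which is also the factor from removing circles; the
  -- other contributes `0 ^ (k + 1) = 0`.
  obtain ⟨k, ⟨hr, h₁, h₂⟩ | ⟨hr, h₁, h₂⟩⟩ := circles_closures hv hf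
  · rw [h₁, h₂, hr.val]
    simp
  · rw [h₁, h₂, hr.val]
    simp [kindVal, gen]

/-! ## Loop value zero -/

/-- There is a nontrivial Temperley-Lieb representation with loop value zero. -/
theorem exists_zeroRep :
    Nonempty (TLRep ℂ (Module.End ℂ ((ℕ → Bool) → ℂ)) 0) := by
  -- Antidiagonal matrices with entries `q`, `1` and `1`, `q⁻¹` have loop value `q + q⁻¹`, which
  -- vanishes at `q = i`.
  let M : Matrix Bool Bool ℂ := fun a b =>
    if a = b then 0 else if a then Complex.I else 1
  let N : Matrix Bool Bool ℂ := fun a b =>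
    if a = b then 0 else if a then 1 else -Complex.I
  have hMN : M * N = 1 := by
    ext a b
    rw [Matrix.mul_apply, Fintype.sum_bool]
    cases a <;> cases b <;> simp [M, N]
  have hNM : N * M = 1 := by
    ext a b
    rw [Matrix.mul_apply, Fintype.sum_bool]
    cases a <;> cases b <;> simp [M, N]
  have h : ∑ a, ∑ b, M a b * N a b = 0 := by simp [M, N]
  exact h ▸ ⟨matrixRep M N hMN hNM⟩

/-- Closing only the right-hand strand turns `1` into a strand with a circle, which is zero, and
`gen 0` into a plain strand; this isolates the second coefficient. -/
theorem TLRep.coeff_unique {E : Type} [Ring E] [Algebra ℂ E] [Nontrivial E] (ρ : TLRep ℂ E 0)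
    {a b a' b' : ℂ} (h : a • (1 : E) + b • ρ.gen 0 = a' • (1 : E) + b' • ρ.gen 0) :
    a = a' ∧ b = b' := by
  have key : ∀ a b : ℂ, ρ.cup 1 * (a • (1 : E) + b • ρ.gen 0) * ρ.cap 1 = b • (1 : E) := by
    intro a b
    have h₁ := ρ.cup_succ_gen 0
    have h₂ := ρ.zigzag_left 0
    simp only [zero_add] at h₁ h₂
    simp [mul_add, add_mul, h₁, h₂, ρ.loop]
  have hb : b = b' := by
    have := key a b
    rw [h, key] at this
    exact (smul_left_injective ℂ one_ne_zero this).symm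
  subst hb
  exact ⟨smul_left_injective ℂ one_ne_zero (add_right_cancel h), rfl⟩

/-! ## Filling and multilinearity -/

namespace TLRep

variable {R E : Type} [CommRing R] [Ring E] [Algebra R E] {d : R} (ρ : TLRep R E d)
  {n : ℕ} (x : Bool → Fin 2 → R)

/-- A filling matters only through its two coefficients. They must be the same in all shifted
representations, because the hole may sit at any position. -/
theorem val_fill (c' : Fin 0 → Fin 2 → R) (c : Fin n → Fin 2 → R) (B : Fin n → List (Piece 0))
    (hB : ∀ k i, (ρ.shiftBy i).val x c' (B k) =
      c k 0 • 1 + c k 1 • (ρ.shiftBy i).gen 0) (w : List (Piece n)) :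
    ρ.val x c' (w.flatMap (Piece.fill B)) = ρ.val x c w := by
  induction w with
  | nil => rfl
  | cons p w ih =>
    rw [List.flatMap_cons, val_append, ih, val_cons]
    congr 1
    obtain ⟨k, i⟩ := p
    cases k with
    | hole k => exact (ρ.val_shift x c' i (B k)).trans (hB k i)
    | _ => exact mul_one _

theorem val_update_of_not_mem (c : Fin n → Fin 2 → R) {k : Fin n} {w : List (Piece n)}
    (hk : Kind.hole k ∉ w.map Piece.kind) (y : Fin 2 → R) :
    ρ.val x (Function.update c k y) w = ρ.val x c w := by
  induction w with
  | nil => rfl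
  | cons p w ih =>
    simp only [List.map_cons, List.mem_cons, not_or] at hk
    rw [val_cons, val_cons, ih hk.2]
    congr 1
    obtain ⟨kd, i⟩ := p
    cases kd with
    | hole k' =>
      have : k' ≠ k := by rintro rfl; exact hk.1 rfl
      simp [kindVal, this]
    | _ => rfl

/-- As the hole occurs exactly once, it enters the value as a single factor; this is the source of
multilinearity. -/
theorem exists_val_update {k : Fin n} {w : List (Piece n)}
    (hk : (w.map Piece.kind).count (Kind.hole k) = 1) (c : Fin n → Fin 2 → R) :
    ∃ u v i, ∀ y, ρ.val x (Function.update c k y) w =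
      u * (y 0 • 1 + y 1 • ρ.gen i) * v := by
  have hm : Kind.hole k ∈ w.map Piece.kind := List.count_pos_iff.1 (by omega)
  obtain ⟨⟨kd, i⟩, hp, hkd⟩ := List.mem_map.1 hm
  obtain rfl := hkd
  obtain ⟨u, v, rfl⟩ := List.append_of_mem hp
  simp only [List.map_append, List.map_cons, List.count_append, List.count_cons_self] at hk
  have hu : Kind.hole k ∉ u.map Piece.kind := List.count_eq_zero.1 (by omega)
  have hv : Kind.hole k ∉ v.map Piece.kind := List.count_eq_zero.1 (by omega)
  refine ⟨ρ.val x c u, ρ.val x c v, i, fun y => ?_⟩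
  rw [val_append, val_cons, ρ.val_update_of_not_mem x c hu, ρ.val_update_of_not_mem x c hv]
  simp [kindVal, mul_assoc]

/-- The value of a punctured ball tangle diagram as a multilinear function of the coefficients of
its holes. -/
noncomputable def valMultilinear (T : TangleDiagram n) :
    MultilinearMap R (fun _ : Fin n => Fin 2 → R) E :=
  MultilinearMap.mk' (fun c => ρ.val x c T.word)
    (fun c k y z => by
      obtain ⟨u, v, i, h⟩ := ρ.exists_val_update x (T.holes k) c
      simp only [h, Pi.add_apply, add_smul, mul_add, add_mul]
      abel)
    (fun c k r y => by
      obtain ⟨u, v, i, h⟩ := ρ.exists_val_update x (T.holes k) c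
      simp [h, mul_add, add_mul, mul_smul, smul_add])

theorem val_smul_holes (T : TangleDiagram n) (r : Fin n → R) (c : Fin n → Fin 2 → R) :
    ρ.val x (fun k => r k • c k) T.word = (∏ k, r k) • ρ.val x c T.word :=
  (ρ.valMultilinear x T).map_smul_univ r c

theorem val_eq_sum (T : TangleDiagram n) (c : Fin n → Fin 2 → R) :
    ρ.val x c T.word = ∑ α : Fin n → Fin 2,
      (∏ k, c k (α k)) • ρ.val x (fun k => Pi.single (α k) 1) T.word := by
  have h : c = fun k => ∑ s, c k s • Pi.single s (1 : R) := by
    funext k s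
    fin_cases s <;> simp
  calc ρ.val x c T.word = ρ.valMultilinear x T (fun k => ∑ s, c k s • Pi.single s (1 : R)) := by
        rw [← h]; rfl
    _ = _ := by
        rw [MultilinearMap.map_sum]
        exact Finset.sum_congr rfl fun α _ => ρ.val_smul_holes x T _ _

theorem val_fill_fundamental (c' : Fin 0 → Fin 2 → R) (T : TangleDiagram n) (α : Fin n → Fin 2) :
    ρ.val x c' (T.fill fun k => fundamental (α k)).word =
      ρ.val x (fun k => Pi.single (α k) 1) T.word := by
  have h : ∀ (s : Fin 2) (i : ℕ), (ρ.shiftBy i).val x c' (fundamental s).word =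
      (Pi.single s 1 : Fin 2 → R) 0 • 1 + (Pi.single s 1 : Fin 2 → R) 1 • (ρ.shiftBy i).gen 0 := by
    intro s i
    fin_cases s <;> simp [fundamental, kindVal, gen]
  exact ρ.val_fill x c' _ _ (fun k i => h (α k) i) T.word

end TLRep

/-- The bracket of the closure `r` of `T` with its holes filled with fundamental tangles. -/
noncomputable def stateBracket {n : ℕ} (T : TangleDiagram n) (α : Fin n → Fin 2) (r : Fin 2) : ℂ :=
  bracket (closure (T.fill fun k => fundamental (α k)) r)

theorem TLRep.val_single_eq {E : Type} [Ring E] [Algebra ℂ E] (ρ : TLRep ℂ E 0) {n : ℕ}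
    (T : TangleDiagram n) (α : Fin n → Fin 2) :
    ρ.val (crossCoeff zeta zeta⁻¹) (fun k => Pi.single (α k) 1) T.word =
      stateBracket T α 0 • 1 + stateBracket T α 1 • ρ.gen 0 := by
  rw [← ρ.val_fill_fundamental _ 0, ρ.val_eq_bracket]
  rfl

theorem TLRep.val_fill_eq {E : Type} [Ring E] [Algebra ℂ E] (ρ : TLRep ℂ E 0) {n : ℕ}
    (T : TangleDiagram n) (B : Fin n → TangleDiagram 0) :
    ρ.val (crossCoeff zeta zeta⁻¹) 0 (T.fill B).word =
      ρ.val (crossCoeff zeta zeta⁻¹) (fun k s => bracket (closure (B k) s)) T.word :=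
  ρ.val_fill _ 0 _ _ (fun k i => (ρ.shiftBy i).val_eq_bracket 0 (B k)) T.word

/-- The value of the filled diagram is computed directly and by multilinear expansion over
fundamental fillings; then the coefficients of `1` and `gen 0` are compared. -/
theorem bracket_fill {n : ℕ} (T : TangleDiagram n) (B : Fin n → TangleDiagram 0) (r : Fin 2) :
    bracket (closure (T.fill B) r) =
      ∑ α : Fin n → Fin 2, (∏ k, bracket (closure (B k) (α k))) * stateBracket T α r := by
  obtain ⟨ρ⟩ := exists_zeroRep
  have h₂ := ρ.val_fill_eq T B
  rw [ρ.val_eq_bracket, ρ.val_eq_sum] at h₂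
  simp only [ρ.val_single_eq, smul_add, smul_smul, Finset.sum_add_distrib,
    ← Finset.sum_smul] at h₂
  obtain ⟨e₀, e₁⟩ := ρ.coeff_unique h₂
  fin_cases r
  · exact e₀
  · exact e₁

/-! ## Isotopy invariance -/

theorem zeta_ne_zero : zeta ≠ 0 := Complex.exp_ne_zero _

theorem zeta_pow_eight : zeta ^ 8 = 1 := by
  rw [show zeta ^ 8 = (zeta ^ 2) ^ 4 by ring, zeta_sq, Complex.I_pow_four]

/-- The factor has to be common to all `α` and `r`, so that the bracket matrix changes by a scalar.
-/
theorem exists_stateBracket_of_move {n : ℕ} {T T' : TangleDiagram n} (h : T.Move T') :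
    ∃ z : ℂ, z ^ 8 = 1 ∧ ∀ α r, stateBracket T α r = z * stateBracket T' α r := by
  obtain ⟨u, v, y, y', hm, hT, hT'⟩ := h
  obtain ⟨ρ⟩ := exists_zeroRep
  obtain ⟨z, hz, hv⟩ := ρ.val_localMove (A := zeta) (B := zeta⁻¹)
    (mul_inv_cancel₀ zeta_ne_zero) (by rw [inv_pow, zeta_sq]; simp) hm
  refine ⟨z, ?_, fun α r => ?_⟩
  · rcases hz with rfl | rfl | rfl
    · exact one_pow 8
    · rw [neg_pow, pow_right_comm, zeta_pow_eight]; norm_num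
    · rw [neg_pow, pow_right_comm, inv_pow, zeta_pow_eight]; norm_num
  · have h : ρ.val (crossCoeff zeta zeta⁻¹) (fun k => Pi.single (α k) 1) T.word =
        z • ρ.val (crossCoeff zeta zeta⁻¹) (fun k => Pi.single (α k) 1) T'.word := by
      simp [hT, hT', hv]
    rw [ρ.val_single_eq, ρ.val_single_eq, smul_add, smul_smul, smul_smul] at h
    obtain ⟨e₀, e₁⟩ := ρ.coeff_unique h
    fin_cases r
    · exact e₀
    · exact e₁

/-! ## The dictionary order -/

/-- The binary digits of `j < 2 ^ n`, beginning with the most significant one. -/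
def digits : (n : ℕ) → ℕ → Fin n → Fin 2
  | 0, _ => Fin.elim0
  | n + 1, j => if j < 2 ^ n then Fin.cons 0 (digits n j) else Fin.cons 1 (digits n (j - 2 ^ n))

theorem sum_digits (n j : ℕ) : ∑ k, (digits n j k : ℕ) = texp n j := by
  induction n generalizing j with
  | zero => rfl
  | succ n ih =>
    rw [digits, texp]
    split_ifs <;> simp [Fin.sum_univ_succ, ih, add_comm]

theorem digits_lt {n i j : ℕ} (hij : i < j) (hj : j < 2 ^ n) :
    toLex (digits n i) < toLex (digits n j) := by
  induction n generalizing i j with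
  | zero => omega
  | succ n ih =>
    have cons_lt : ∀ (s : Fin 2) {f g : Fin n → Fin 2}, toLex f < toLex g →
        toLex (Fin.cons s f : Fin (n + 1) → Fin 2) <
          toLex (Fin.cons s g : Fin (n + 1) → Fin 2) := by
      rintro s f g ⟨k, hk, hlt⟩
      refine ⟨k.succ, fun l hl => ?_, hlt⟩
      cases l using Fin.cases with
      | zero => rfl
      | succ l => exact hk l (Fin.succ_lt_succ_iff.1 hl)
    rw [pow_succ] at hj
    rw [digits, digits]
    split_ifs with h₁ h₂ h₂
    · exact cons_lt 0 (ih hij h₂)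
    · exact ⟨0, fun l hl => absurd hl (Fin.not_lt_zero l), by simp⟩
    · omega
    · exact cons_lt 1 (ih (by omega) (by omega))

/-- Both enumerations are order isomorphisms from `Fin (2 ^ n)`, and such an isomorphism is unique.
-/
theorem alpha_eq_digits (n : ℕ) (j : Fin (2 ^ n)) : alpha n j = digits n j := by
  have hm : StrictMono fun j : Fin (2 ^ n) => toLex (digits n j) := fun i j h => digits_lt h j.2
  have hb : Function.Bijective fun j : Fin (2 ^ n) => toLex (digits n j) :=
    (Fintype.bijective_iff_injective_and_card _).2 ⟨hm.injective, by simp⟩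
  have := Subsingleton.elim (monoEquivOfFin (Lex (Fin n → Fin 2)) (k := 2 ^ n) (by simp))
    (hm.orderIsoOfSurjective _ hb.surjective)
  rw [alpha, this]
  rfl

/-- Lets the weight `(-i) ^ t_j` be distributed over the holes, one factor for each. -/
theorem texp_eq (n : ℕ) (j : Fin (2 ^ n)) : texp n j = ∑ k, (alpha n j k : ℕ) := by
  rw [alpha_eq_digits, sum_digits]

theorem alpha_bijective (n : ℕ) : Function.Bijective (alpha n) :=
  (monoEquivOfFin (Lex (Fin n → Fin 2)) (k := 2 ^ n) (by simp)).bijective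

/-! ## Integrality -/

/-- The one-dimensional Temperley-Lieb representation with loop value `-1`. -/
def signRep : TLRep ℤ ℤ (-1) where
  cup i := (-1) ^ i
  cap i := -(-1) ^ i
  zigzag_left i := by
    rw [pow_succ]
    linear_combination (Even.neg_one_pow ⟨i, rfl⟩ : (-1 : ℤ) ^ (i + i) = 1)
  zigzag_right i := by
    rw [pow_succ]
    linear_combination (Even.neg_one_pow ⟨i, rfl⟩ : (-1 : ℤ) ^ (i + i) = 1)
  loop i := by
    rw [smul_eq_mul]
    linear_combination -(Even.neg_one_pow ⟨i, rfl⟩ : (-1 : ℤ) ^ (i + i) = 1)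
  cup_cup i r := by ring
  cup_cap i r := by ring
  cap_cup i r := by ring
  cap_cap i r := by ring

/-- The sign of a word without crossings. -/
def wordSign (v : List (Piece 0)) : ℤ := signRep.val 0 0 v

theorem wordSign_append (v w : List (Piece 0)) :
    wordSign (v ++ w) = wordSign v * wordSign w := signRep.val_append 0 0 v w

theorem Plain.wordSign_eq {v : List (Piece 0)} (hv : Plain v) :
    wordSign v = 1 ∨ wordSign v = -1 := by
  induction v with
  | nil => exact Or.inl rfl
  | cons p v ih =>
    have h₁ : wordSign [p] = 1 ∨ wordSign [p] = -1 := by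
      obtain ⟨k, i⟩ := p
      rcases hv ⟨k, i⟩ List.mem_cons_self with h | h <;> obtain rfl := h <;>
        rcases neg_one_pow_eq_or ℤ i with h | h <;>
        simp [wordSign, TLRep.kindVal, signRep, h]
    have h₂ := ih fun q hq => hv q (List.mem_cons_of_mem _ hq)
    rw [← List.singleton_append, wordSign_append]
    rcases h₁ with h₁ | h₁ <;> rcases h₂ with h₂ | h₂ <;> simp [h₁, h₂]

/-- The phase that is assigned to a sign. -/
noncomputable def phase (s : ℤ) : ℂ := if s = 1 then 1 else Complex.I

theorem phase_pow_eight (s : ℤ) : phase s ^ 8 = 1 := by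
  unfold phase
  split_ifs
  · exact one_pow 8
  · rw [show Complex.I ^ 8 = (Complex.I ^ 4) ^ 2 by ring, Complex.I_pow_four, one_pow]

/-- The phase is multiplicative only up to sign, which is harmless in an additive group. -/
theorem phase_mul {s t : ℤ} (hs : s = 1 ∨ s = -1) (ht : t = 1 ∨ t = -1) :
    phase t * phase s = phase (s * t) ∨ phase t * phase s = -phase (s * t) := by
  rcases hs with rfl | rfl <;> rcases ht with rfl | rfl <;> simp [phase]

/-! ### Lattices of phase-weighted crossingless words. -/

section Lattice

variable {E : Type} [Ring E] [Algebra ℂ E] (ρ : TLRep ℂ E 0)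

/-- The value of a word without crossings, multiplied by its phase. -/
noncomputable def phaseVal (v : List (Piece 0)) : E := phase (wordSign v) • ρ.val 0 0 v

/-- The lattice spanned by the words without crossings with `a` strands at the top. -/
def lattice (a : ℕ) : AddSubgroup E :=
  AddSubgroup.closure {y | ∃ v, Plain v ∧ Fits v 2 a ∧ phaseVal ρ v = y}

theorem lattice_mul {q : List (Piece 0)} (hq : Plain q) {a b : ℕ} (hf : Fits q a b) {y : E}
    (hy : y ∈ lattice ρ a) : phase (wordSign q) • (y * ρ.val 0 0 q) ∈ lattice ρ b := by
  induction hy using AddSubgroup.closure_induction with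
  | mem y h =>
    obtain ⟨v, hv, hfv, rfl⟩ := h
    have hm : phaseVal ρ (v ++ q) ∈ lattice ρ b :=
      AddSubgroup.subset_closure ⟨v ++ q, hv.append hq, hfv.append hf, rfl⟩
    rw [phaseVal, TLRep.val_append, wordSign_append] at hm
    rw [phaseVal, smul_mul_assoc, smul_smul]
    rcases phase_mul hv.wordSign_eq hq.wordSign_eq with h | h
    · rwa [h]
    · rw [h, neg_smul]
      exact neg_mem hm
  | zero => simp
  | add y z _ _ hy hz => rw [add_mul, smul_add]; exact add_mem hy hz
  | neg y _ hy => rw [neg_mul, smul_neg]; exact neg_mem hy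

/-- The word of a generator has sign `-1`, hence phase `i`. -/
theorem lattice_mul_gen {a i r : ℕ} (ha : a = i + 2 + r) {y : E} (hy : y ∈ lattice ρ a) :
    Complex.I • (y * ρ.gen i) ∈ lattice ρ a := by
  have hs : wordSign [⟨Kind.cap, i⟩, ⟨Kind.cup, i⟩] = -1 := by
    rcases neg_one_pow_eq_or ℤ i with h | h <;> simp [wordSign, TLRep.kindVal, signRep, h]
  have hq : Plain (n := 0) [⟨Kind.cap, i⟩, ⟨Kind.cup, i⟩] := by simp [Plain]
  have := lattice_mul ρ hq (a := a) (b := a) ⟨r, ha, r, rfl, ha.symm⟩ hy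
  rw [hs] at this
  simpa [phase, TLRep.kindVal, TLRep.gen] using this

/-- The coefficients of the fundamental tangles, multiplied by suitable units. -/
noncomputable def holeCoeff {n : ℕ} (α : Fin n → Fin 2) (k : Fin n) : Fin 2 → ℂ :=
  (-Complex.I) ^ (α k : ℕ) • Pi.single (α k) 1

/-- After the factor `z`, a crossing becomes `1 ± i·gen`, and a hole is `1` or `-i·gen`. The factor
does not depend on `α`, so one factor will serve all columns of the matrix. -/
theorem exists_kindVal_mem_lattice {n : ℕ} (p : Piece n) (r : ℕ) :
    ∃ z : ℂ, z ^ 8 = 1 ∧ ∀ α : Fin n → Fin 2, ∀ y ∈ lattice ρ (p.left + p.kind.src + r),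
      z • (y * ρ.kindVal (crossCoeff zeta zeta⁻¹) (holeCoeff α) p.kind p.left) ∈
        lattice ρ (p.left + p.kind.tgt + r) := by
  have hz := zeta_ne_zero
  have hI : zeta⁻¹ * zeta⁻¹ = -Complex.I := by rw [← sq, inv_pow, zeta_sq, Complex.inv_I]
  obtain ⟨k, i⟩ := p
  rcases k with _ | _ | (_ | _) | k
  · refine ⟨_, phase_pow_eight (wordSign [⟨Kind.cup, i⟩]), fun α y hy => ?_⟩
    have hq : Plain (n := 0) [⟨Kind.cup, i⟩] := by simp [Plain]
    have := lattice_mul ρ hq ⟨r, rfl, rfl⟩ hy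
    rwa [TLRep.val_cons, TLRep.val_nil, mul_one] at this
  · refine ⟨_, phase_pow_eight (wordSign [⟨Kind.cap, i⟩]), fun α y hy => ?_⟩
    have hq : Plain (n := 0) [⟨Kind.cap, i⟩] := by simp [Plain]
    have := lattice_mul ρ hq ⟨r, rfl, rfl⟩ hy
    rwa [TLRep.val_cons, TLRep.val_nil, mul_one] at this
  · refine ⟨zeta, zeta_pow_eight, fun α y hy => ?_⟩
    have : _ ∈ lattice ρ (i + 2 + r) := add_mem hy (lattice_mul_gen ρ rfl hy)
    change _ ∈ lattice ρ (i + 2 + r)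
    simpa [TLRep.kindVal, crossCoeff, mul_add, smul_smul, hz, ← sq, zeta_sq] using this
  · refine ⟨zeta⁻¹, by rw [inv_pow, zeta_pow_eight, inv_one], fun α y hy => ?_⟩
    have : _ ∈ lattice ρ (i + 2 + r) := sub_mem hy (lattice_mul_gen ρ rfl hy)
    change _ ∈ lattice ρ (i + 2 + r)
    simpa [TLRep.kindVal, crossCoeff, mul_add, smul_smul, hz, hI, sub_eq_add_neg] using this
  · refine ⟨1, one_pow 8, fun α y hy => ?_⟩
    change y ∈ lattice ρ (i + 2 + r) at hy
    have h : ∀ s : Fin 2, y * (((-Complex.I) ^ (s : ℕ) • (Pi.single s 1 : Fin 2 → ℂ)) 0 • 1 +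
        ((-Complex.I) ^ (s : ℕ) • (Pi.single s 1 : Fin 2 → ℂ)) 1 • ρ.gen i) ∈
          lattice ρ (i + 2 + r) := by
      intro s
      fin_cases s
      · simpa using hy
      · simpa using neg_mem (lattice_mul_gen ρ rfl hy)
    rw [one_smul]
    exact h (α k)

theorem exists_val_mem_lattice {n : ℕ} {w : List (Piece n)} {a b : ℕ} (hw : Fits w a b) :
    ∃ z : ℂ, z ^ 8 = 1 ∧ ∀ α : Fin n → Fin 2, ∀ y ∈ lattice ρ a,
      z • (y * ρ.val (crossCoeff zeta zeta⁻¹) (holeCoeff α) w) ∈ lattice ρ b := by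
  induction w generalizing a with
  | nil =>
    obtain rfl : a = b := hw
    exact ⟨1, one_pow 8, fun α y hy => by simpa using hy⟩
  | cons p w ih =>
    obtain ⟨r, rfl, hw⟩ := hw
    obtain ⟨z, hz, h⟩ := exists_kindVal_mem_lattice ρ p r
    obtain ⟨z', hz', h'⟩ := ih hw
    refine ⟨z' * z, by rw [mul_pow, hz, hz', one_mul], fun α y hy => ?_⟩
    have := h' α _ (h α y hy)
    rwa [smul_mul_assoc, smul_smul, mul_assoc] at this

/-- A spanning word with a removed circle is zero at loop value 0. Otherwise it equals `1` or `gen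
0` in every representation, so its sign, and with it its phase, is known. -/
theorem exists_int_of_mem_lattice {y : E} (hy : y ∈ lattice ρ 2) :
    ∃ m l : ℤ, y = (m : ℂ) • 1 + (l * Complex.I) • ρ.gen 0 := by
  induction hy using AddSubgroup.closure_induction with
  | mem y h =>
    obtain ⟨v, hv, hf, rfl⟩ := h
    obtain ⟨k, hk | hk⟩ := hv.reduces_of_fits_two hf
    · rcases k with _ | k
      · have hs : wordSign v = 1 := by simp [wordSign, hk.val]
        exact ⟨1, 0, by simp [phaseVal, hs, hk.val, phase]⟩
      · exact ⟨0, 0, by simp [phaseVal, hk.val]⟩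
    · rcases k with _ | k
      · have hs : wordSign v = -1 := by
          simp [wordSign, hk.val, TLRep.kindVal, signRep]
        exact ⟨0, 1, by simp [phaseVal, hs, hk.val, phase, TLRep.kindVal, TLRep.gen]⟩
      · exact ⟨0, 0, by simp [phaseVal, hk.val]⟩
  | zero => exact ⟨0, 0, by simp⟩
  | add y z _ _ hy hz =>
    obtain ⟨m, l, rfl⟩ := hy
    obtain ⟨m', l', rfl⟩ := hz
    refine ⟨m + m', l + l', ?_⟩
    push_cast
    module
  | neg y _ hy =>
    obtain ⟨m, l, rfl⟩ := hy
    refine ⟨-m, -l, ?_⟩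
    push_cast
    module

theorem val_holeCoeff {n : ℕ} (T : TangleDiagram n) (α : Fin n → Fin 2) :
    ρ.val (crossCoeff zeta zeta⁻¹) (holeCoeff α) T.word =
      (-Complex.I) ^ (∑ k, (α k : ℕ)) •
        (stateBracket T α 0 • 1 + stateBracket T α 1 • ρ.gen 0) := by
  rw [← ρ.val_single_eq, ← Finset.prod_pow_eq_pow_sum]
  exact ρ.val_smul_holes _ T _ _

end Lattice

/-! ### Integral multiples of the bracket matrix and their class up to sign. -/

theorem bracketMatrix_apply {n : ℕ} (T : TangleDiagram n) (r : Fin 2) (j : Fin (2 ^ n)) :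
    bracketMatrix T r j = (-Complex.I) ^ (∑ k, (alpha n j k : ℕ)) * Complex.I ^ (r : ℕ) *
      stateBracket T (alpha n j) r := by
  rw [← texp_eq]
  rfl

theorem integralMultiples_nonempty {n : ℕ} (T : TangleDiagram n) :
    (integralMultiples T).Nonempty := by
  obtain ⟨ρ⟩ := exists_zeroRep
  obtain ⟨z, hz, h⟩ := exists_val_mem_lattice ρ T.fits
  have h₁ : (1 : Module.End ℂ ((ℕ → Bool) → ℂ)) ∈ lattice ρ 2 :=
    AddSubgroup.subset_closure ⟨[], by simp [Plain], rfl, by simp [phaseVal, wordSign, phase]⟩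
  have h₂ : ∀ α : Fin n → Fin 2, ∃ m l : ℤ,
      z * ((-Complex.I) ^ (∑ k, (α k : ℕ)) * stateBracket T α 0) = m ∧
      z * ((-Complex.I) ^ (∑ k, (α k : ℕ)) * stateBracket T α 1) = l * Complex.I := fun α => by
    obtain ⟨m, l, e⟩ := exists_int_of_mem_lattice ρ (h α 1 h₁)
    rw [one_mul, val_holeCoeff, smul_add, smul_add, smul_smul, smul_smul, smul_smul,
      smul_smul, mul_assoc, mul_assoc] at e
    exact ⟨m, l, ρ.coeff_unique e⟩
  choose m l hm hl using h₂
  -- The second row of the bracket matrix carries an extra `i`, and `i · (l i) = -l`.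
  refine ⟨Matrix.of fun r j => if r = 0 then m (alpha n j) else -l (alpha n j), z, hz, ?_⟩
  ext r j
  rw [Matrix.smul_apply, bracketMatrix_apply, smul_eq_mul, Matrix.map_apply]
  fin_cases r
  · simpa using (hm (alpha n j)).symm
  · have := hl (alpha n j)
    simp
    linear_combination -Complex.I * this - (l (alpha n j) : ℂ) * Complex.I_mul_I

/-- Corresponding entries have equal eighth powers, so a nonzero integer entry forces `z' = ±z`. If
`M` is zero, so is `M'`. -/
theorem eq_or_eq_neg_of_map_eq_smul {ι κ : Type} {X : Matrix ι κ ℂ} {M M' : Matrix ι κ ℤ}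
    {z z' : ℂ} (hz : z ^ 8 = 1) (hz' : z' ^ 8 = 1)
    (hM : M.map (fun m : ℤ => (m : ℂ)) = z • X) (hM' : M'.map (fun m : ℤ => (m : ℂ)) = z' • X) :
    M = M' ∨ M = -M' := by
  have h : ∀ i j, z' * (M i j : ℂ) = z * M' i j := fun i j => by
    have e := congrFun (congrFun hM i) j
    have e' := congrFun (congrFun hM' i) j
    simp only [Matrix.map_apply, Matrix.smul_apply, smul_eq_mul] at e e'
    rw [e, e']
    ring
  have hz₀ : z ≠ 0 := by rintro rfl; norm_num at hz
  by_cases h₀ : ∃ i j, M i j ≠ 0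
  · obtain ⟨i, j, hij⟩ := h₀
    have h₈ : (M i j) ^ 8 = (M' i j) ^ 8 := by
      have := congrArg (· ^ 8) (h i j)
      simp only [mul_pow, hz, hz', one_mul] at this
      exact_mod_cast this
    have hij' : (M i j : ℂ) ≠ 0 := by exact_mod_cast hij
    rcases (pow_eq_pow_iff_cases.1 h₈) with h₁ | h₁ | h₁
    · norm_num at h₁
    · have hzz : z' = z := by
        have := h i j
        rw [← h₁] at this
        exact mul_right_cancel₀ hij' this
      refine Or.inl (Matrix.ext fun a b => ?_)
      have := h a b
      rw [hzz] at this
      exact_mod_cast mul_left_cancel₀ hz₀ this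
    · have hzz : z' = -z := by
        have := h i j
        rw [← neg_eq_iff_eq_neg.2 h₁.1] at this
        push_cast at this
        refine mul_right_cancel₀ hij' ?_
        linear_combination this
      refine Or.inr (Matrix.ext fun a b => ?_)
      have := h a b
      rw [hzz] at this
      have h₂ : (M a b : ℂ) = -M' a b := mul_left_cancel₀ hz₀ (by linear_combination -this)
      rw [Matrix.neg_apply]
      exact_mod_cast h₂
  · push Not at h₀
    refine Or.inl (Matrix.ext fun a b => ?_)
    have := h a b
    rw [h₀] at this ⊢
    simp [hz₀] at this
    exact this.symm

theorem PM.mk_eq_mk {a b : ℕ} {X Y : Matrix (Fin a) (Fin b) ℤ} :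
    PM.mk X = PM.mk Y ↔ X = Y ∨ X = -Y :=
  ⟨fun h => Quotient.exact (s := signSetoid a b) h,
    fun h => Quotient.sound (s := signSetoid a b) h⟩

theorem setOf_mk_eq {n : ℕ} {T : TangleDiagram n} {M : Matrix (Fin 2) (Fin (2 ^ n)) ℤ}
    (hM : M ∈ integralMultiples T) : {M' | PM.mk M' = PM.mk M} = integralMultiples T := by
  obtain ⟨z, hz, h⟩ := hM
  ext M'
  rw [Set.mem_ofPred_eq, PM.mk_eq_mk]
  constructor
  · rintro (rfl | rfl)
    · exact ⟨z, hz, h⟩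
    · refine ⟨-z, by rw [neg_pow, hz]; norm_num, ?_⟩
      rw [neg_smul, ← h]
      ext i j
      simp
  · rintro ⟨z', hz', h'⟩
    exact eq_or_eq_neg_of_map_eq_smul hz' hz h' h

/-- Since an integral multiple exists, the choice in `F` is never the arbitrary default. -/
theorem setOf_mk_eq_F {n : ℕ} (T : TangleDiagram n) :
    {M | PM.mk M = F T} = integralMultiples T := by
  obtain ⟨M, hM⟩ := integralMultiples_nonempty T
  exact Classical.epsilon_spec (p := fun q => {M | PM.mk M = q} = integralMultiples T)
    ⟨PM.mk M, setOf_mk_eq hM⟩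

theorem F_eq_mk {n : ℕ} {T : TangleDiagram n} {M : Matrix (Fin 2) (Fin (2 ^ n)) ℤ}
    (hM : M ∈ integralMultiples T) : F T = PM.mk M := by
  rw [← setOf_mk_eq_F] at hM
  exact Eq.symm hM

theorem F_eq_of_move {n : ℕ} {T T' : TangleDiagram n} (h : T.Move T') : F T = F T' := by
  obtain ⟨z, hz, hb⟩ := exists_stateBracket_of_move h
  obtain ⟨M, z', hz', hM⟩ := integralMultiples_nonempty T
  have hX : bracketMatrix T = z • bracketMatrix T' := by
    ext r j
    rw [Matrix.smul_apply, bracketMatrix_apply, bracketMatrix_apply, hb, smul_eq_mul]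
    ring
  rw [F_eq_mk ⟨z', hz', hM⟩, F_eq_mk (T := T') ⟨z' * z, by rw [mul_pow, hz, hz', one_mul], ?_⟩]
  rw [hM, hX, smul_smul]

/-! ### The filling formula. -/

theorem fill_eq_self (C : TangleDiagram 0) (B : Fin 0 → TangleDiagram 0) : C.fill B = C := by
  obtain ⟨w, hw, hh⟩ := C
  have h : Piece.fill (fun k => (B k).word) = fun p => [p] := by
    funext p
    revert p
    rintro ⟨_ | _ | _ | k, i⟩
    · rfl
    · rfl
    · rfl
    · exact k.elim0
  have e : w.flatMap (Piece.fill fun k => (B k).word) = w := by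
    rw [h]
    exact List.flatMap_singleton' w
  simp only [TangleDiagram.fill, e]

theorem bracketMatrix_fill {n : ℕ} (T : TangleDiagram n) (B : Fin n → TangleDiagram 0)
    (r : Fin 2) (s : Fin (2 ^ 0)) :
    bracketMatrix (T.fill B) r s =
      ∑ j, bracketMatrix T r j * ∏ k, bracketMatrix (B k) (alpha n j k) s := by
  have h : ∀ (C : TangleDiagram 0) (r : Fin 2), bracketMatrix C r s =
      Complex.I ^ (r : ℕ) * bracket (closure C r) := fun C r => by
    rw [bracketMatrix, fill_eq_self]
    simp [texp]
  simp only [h, bracketMatrix_apply, bracket_fill]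
  rw [← (alpha_bijective n).sum_comp, Finset.mul_sum]
  refine Finset.sum_congr rfl fun j _ => ?_
  -- The weight of column `j` cancels the factors `i` in the second entries of the columns of the
  -- fillings; this explains the exponents `t_j`.
  have e : (-Complex.I) ^ (∑ k, (alpha n j k : ℕ)) * ∏ k, Complex.I ^ (alpha n j k : ℕ) = 1 := by
    rw [← Finset.prod_pow_eq_pow_sum, ← Finset.prod_mul_distrib]
    simp [← mul_pow]
  rw [Finset.prod_mul_distrib]
  linear_combination -(Complex.I ^ (r : ℕ) * stateBracket T (alpha n j) r *
    ∏ k, bracket (closure (B k) (alpha n j k))) * e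

theorem F_fill {n : ℕ} (T : TangleDiagram n) (B : Fin n → TangleDiagram 0) :
    F (T.fill B) = (F T).mul (PM.xi fun k => F (B k)) := by
  obtain ⟨M, z, hz, hM⟩ := integralMultiples_nonempty T
  have hB := fun k => integralMultiples_nonempty (B k)
  choose N hN using hB
  have hN' := hN
  choose y hy hNy using hN'
  have e : (fun k => F (B k)) = fun k => PM.mk (N k) := funext fun k => F_eq_mk (hN k)
  rw [e, F_eq_mk ⟨z, hz, hM⟩]
  refine Eq.trans (F_eq_mk (M := M * xi N) ⟨z * ∏ k, y k, ?_, ?_⟩) ?_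
  · rw [mul_pow, hz, ← Finset.prod_pow]
    simp [hy]
  · ext r s
    have h₁ : ∀ j, (M r j : ℂ) = z * bracketMatrix T r j := fun j => congrFun (congrFun hM r) j
    have h₂ : ∀ k a, (N k a s : ℂ) = y k * bracketMatrix (B k) a s :=
      fun k a => congrFun (congrFun (hNy k) a) s
    rw [Matrix.map_apply, Matrix.mul_apply, Matrix.smul_apply, bracketMatrix_fill]
    simp only [xi, Int.cast_sum, Int.cast_mul, Int.cast_prod, h₁, h₂, Finset.prod_mul_distrib,
      smul_eq_mul, Finset.mul_sum]
    exact Finset.sum_congr rfl fun j _ => by ring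
  · exact congrArg (PM.mul (PM.mk M)) (PM.xi_mk N).symm

end BallTangle

open BallTangle in
theorem theorem3p6 (n : ℕ) :
    (∀ T : TangleDiagram n, {M | PM.mk M = F T} = integralMultiples T) ∧
    (∀ T T' : TangleDiagram n, T.Isotopic T' → F T = F T') ∧
    (∀ (T : TangleDiagram n) (B : Fin n → TangleDiagram 0),
      F (T.fill B) = (F T).mul (PM.xi fun k => F (B k))) := by
  refine ⟨setOf_mk_eq_F, fun T T' h => ?_, F_fill⟩
  induction h with
  | rel T T' h => exact F_eq_of_move h
  | refl T => rfl
  | symm T T' _ ih => exact ih.symm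
  | trans T T' T'' _ _ ih ih' => exact ih.trans ih'
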